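/- Let $(\Omega,\Sigma,\mu)$ be a finite measure space, let $\mathbb{F}$ be the real or complex field, let $L_0(\mu)$ be the space of (classes modulo null sets of) $\mathbb{F}$-valued measurable functions, and let $L_0^+(\mu)$ be the cone of measurable functions with values in $[0,\infty]$. A \emph{function norm} over $(\Omega,\Sigma,\mu)$ is a map $\rho\colon L_0^+(\mu)\to[0,\infty]$ such that, for all $f,g,f_n\in L_0^+(\mu)$: (a) $\rho(f)=0$ if and only if $f=0$ a.e.; (b) $\rho(f+g)\le\rho(f)+\rho(g)$; (c) $\rho(tf)=t\rho(f)$ for $t\in[0,\infty]$ (with $0\cdot\infty=0$); (d) $\rho(f)\le\rho(g)$ whenever $f\le g$ a.e.; (e) $\rho(\chi_E)<\infty$ for every $E\in\Sigma$ with $\mu(E)<\infty$; (f) $\rho(\lim_n f_n)=\lim_n\rho(f_n)$ for every non-decreasing sequence $(f_n)_{n=1}^\infty$; (g) for every $E\in\Sigma$ with $\mu(E)<\infty$ there is a constant $C_E<\infty$ with $\int_E f\,d\mu\le C_E\,\rho(f)$ for all $f$. Let $L_\rho=\{f\in L_0(\mu)\colon \rho(|f|)<\infty\}$ with the norm $\|f\|_\rho=\rho(|f|)$.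 Suppose that $L_\rho\subseteq L_2(\mu)$ and that $L_\rho$ has Rademacher type $2$, that is, there is a constant $C$ such that the average of $\left\|\sum_{i=1}^n\varepsilon_i x_i\right\|_\rho$ over all signs $\varepsilon_i=\pm1$ is at most $C\left(\sum_{i=1}^n\|x_i\|_\rho^2\right)^{1/2}$ for every finite family $(x_i)_{i=1}^n$ in $L_\rho$. Let $\Psi=(\psi_n)_{n=1}^\infty$ be an unconditional basic sequence in $L_\rho$ (for every permutation $\pi$ of $\mathbb{N}$, the sequence $(\psi_{\pi(n)})_{n=1}^\infty$ is a Schauder basis of its closed linear span) which is semi-normalized ($0<\inf_n\|\psi_n\|_\rho\le\sup_n\|\psi_n\|_\rho<\infty$). (i) If $\inf_n\|\psi_n\|_{L_2(\mu)}>0$, then $\Psi$ is equivalent to the unit vector system $(e_n)_{n=1}^\infty$ of $\ell_2$, that is, there is a linear homeomorphism from the closed linear span of $\Psi$ onto $\ell_2$ mapping $\psi_n$ to $e_n$ for every $n$. (ii) If $\inf_n\|\psi_n\|_{L_2(\mu)}=0$, then there are a subsequence $(\psi_{n_k})_{k=1}^\infty$ of $\Psi$, a linear homeomorphism $S$ of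 $L_\rho$ onto itself, and a sequence $(\varphi_k)_{k=1}^\infty$ in $L_\rho$ such that $S(\psi_{n_k})=\varphi_k$ for every $k$, each $\varphi_k$ is a simple function, the supports of the $\varphi_k$ are pairwise disjoint up to null sets, and $$\lim_k \operatorname{ess\,inf}\{|\varphi_k(\omega)|\colon \omega\in\operatorname{supp}(\varphi_k)\}=\infty.$$ -/

import Mathlib

open MeasureTheory Filter Topology
open scoped ENNReal NNReal

/-- A function norm over the measure space `(Ω, Σ, μ)`. It acts on measurable `[0,∞]`-valued
functions; all the axioms concern measurable functions only, and by `mono` the value on such a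
function depends only on its class modulo null sets. (Values on non-measurable functions are
never used.) -/
structure FunctionNorm {Ω : Type*} [MeasurableSpace Ω] (μ : Measure Ω) where
  /-- the underlying gauge -/
  toFun : (Ω → ℝ≥0∞) → ℝ≥0∞
  eq_zero_iff : ∀ f, Measurable f → (toFun f = 0 ↔ f =ᵐ[μ] 0)
  add_le : ∀ f g, Measurable f → Measurable g → toFun (f + g) ≤ toFun f + toFun g
  const_mul : ∀ (t : ℝ≥0∞) (f), Measurable f → toFun (fun ω => t * f ω) = t * toFun f
  mono : ∀ f g, Measurable f → Measurable g → f ≤ᵐ[μ] g → toFun f ≤ toFun g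
  indicator_lt_top : ∀ E, MeasurableSet E → μ E < ∞ → toFun (E.indicator 1) < ∞
  fatou : ∀ (f : ℕ → Ω → ℝ≥0∞) (g : Ω → ℝ≥0∞), (∀ n, Measurable (f n)) → Measurable g →
    (∀ᵐ ω ∂μ, Monotone fun n => f n ω) →
    (∀ᵐ ω ∂μ, Tendsto (fun n => f n ω) atTop (𝓝 (g ω))) →
    Tendsto (fun n => toFun (f n)) atTop (𝓝 (toFun g))
  lintegral_le : ∀ E, MeasurableSet E → μ E < ∞ →
    ∃ C : ℝ≥0, ∀ f, Measurable f → ∫⁻ ω in E, f ω ∂μ ≤ C * toFun f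

namespace FunctionNorm

section Space

variable {Ω : Type*} [MeasurableSpace Ω] {μ : Measure Ω} (ρ : FunctionNorm μ)
  {𝕜 : Type*} [RCLike 𝕜]

/-- `ρ(|f|)` for a class `f ∈ L₀(μ)` of `𝕜`-valued measurable functions. -/
noncomputable def gauge (f : Ω →ₘ[μ] 𝕜) : ℝ≥0∞ := ρ.toFun fun ω => ‖f ω‖ₑ

theorem measurable_enorm_coe (f : Ω →ₘ[μ] 𝕜) : Measurable fun ω => ‖f ω‖ₑ :=
  f.stronglyMeasurable.enorm

theorem gauge_eq_zero_iff (f : Ω →ₘ[μ] 𝕜) : ρ.gauge f = 0 ↔ f = 0 := by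
  rw [gauge, ρ.eq_zero_iff _ (measurable_enorm_coe f)]
  constructor
  · intro h
    apply AEEqFun.ext
    filter_upwards [h, AEEqFun.coeFn_zero (α := Ω) (β := 𝕜) (μ := μ)] with ω h1 h2
    rw [h2]
    simpa using h1
  · rintro rfl
    filter_upwards [AEEqFun.coeFn_zero (α := Ω) (β := 𝕜) (μ := μ)] with ω h2
    simp [h2]

theorem gauge_add_le (f g : Ω →ₘ[μ] 𝕜) : ρ.gauge (f + g) ≤ ρ.gauge f + ρ.gauge g := by
  refine le_trans (ρ.mono _ _ (measurable_enorm_coe _)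
    ((measurable_enorm_coe f).add (measurable_enorm_coe g)) ?_)
    (ρ.add_le _ _ (measurable_enorm_coe f) (measurable_enorm_coe g))
  filter_upwards [AEEqFun.coeFn_add f g] with ω h
  rw [h]
  exact enorm_add_le _ _

theorem gauge_smul (c : 𝕜) (f : Ω →ₘ[μ] 𝕜) : ρ.gauge (c • f) = ‖c‖ₑ * ρ.gauge f := by
  have h : (fun ω => ‖(c • f : Ω →ₘ[μ] 𝕜) ω‖ₑ) =ᵐ[μ] fun ω => ‖c‖ₑ * ‖f ω‖ₑ := by
    filter_upwards [AEEqFun.coeFn_smul c f] with ω h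
    simp [h]
  have hm : Measurable fun ω => ‖c‖ₑ * ‖f ω‖ₑ := (measurable_enorm_coe f).const_mul _
  rw [gauge, gauge, ← ρ.const_mul _ _ (measurable_enorm_coe f)]
  exact le_antisymm (ρ.mono _ _ (measurable_enorm_coe _) hm h.le)
    (ρ.mono _ _ hm (measurable_enorm_coe _) h.symm.le)

/-- The function space `L_ρ = {f ∈ L₀(μ) : ρ(|f|) < ∞}`. -/
def space (𝕜 : Type*) [RCLike 𝕜] : Submodule 𝕜 (Ω →ₘ[μ] 𝕜) where
  carrier := {f | ρ.gauge f < ∞}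
  add_mem' := fun {f g} hf hg =>
    lt_of_le_of_lt (ρ.gauge_add_le f g) (ENNReal.add_lt_top.2 ⟨hf, hg⟩)
  zero_mem' := by
    change ρ.gauge (0 : Ω →ₘ[μ] 𝕜) < ∞
    rw [(ρ.gauge_eq_zero_iff _).2 rfl]
    exact ENNReal.zero_lt_top
  smul_mem' := fun c f hf => by
    change ρ.gauge (c • f) < ∞
    rw [gauge_smul]
    exact ENNReal.mul_lt_top enorm_lt_top hf

theorem gauge_coe_ne_top (f : ρ.space 𝕜) : ρ.gauge (f : Ω →ₘ[μ] 𝕜) ≠ ∞ := ne_of_lt f.2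

/-- The norm `‖f‖_ρ = ρ(|f|)` on `L_ρ`. -/
noncomputable instance : Norm (ρ.space 𝕜) := ⟨fun f => (ρ.gauge (f : Ω →ₘ[μ] 𝕜)).toReal⟩

theorem norm_def (f : ρ.space 𝕜) : ‖f‖ = (ρ.gauge (f : Ω →ₘ[μ] 𝕜)).toReal := rfl

theorem normedSpaceCore : NormedSpace.Core 𝕜 (ρ.space 𝕜) where
  norm_nonneg := fun _ => ENNReal.toReal_nonneg
  norm_smul := fun c f => by
    rw [norm_def, norm_def, Submodule.coe_smul, gauge_smul, ENNReal.toReal_mul, toReal_enorm]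
  norm_triangle := fun f g => by
    rw [norm_def, norm_def, norm_def,
      ← ENNReal.toReal_add (ρ.gauge_coe_ne_top f) (ρ.gauge_coe_ne_top g)]
    exact ENNReal.toReal_mono
      (ENNReal.add_ne_top.2 ⟨ρ.gauge_coe_ne_top f, ρ.gauge_coe_ne_top g⟩) (ρ.gauge_add_le _ _)
  norm_eq_zero_iff := fun f => by
    rw [norm_def, ENNReal.toReal_eq_zero_iff, or_iff_left (ρ.gauge_coe_ne_top f),
      gauge_eq_zero_iff, Submodule.coe_eq_zero]

noncomputable instance : NormedAddCommGroup (ρ.space 𝕜) :=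
  NormedAddCommGroup.ofCore ρ.normedSpaceCore

noncomputable instance : NormedSpace 𝕜 (ρ.space 𝕜) :=
  NormedSpace.ofCore ρ.normedSpaceCore

end Space

end FunctionNorm

section Sequences

variable (𝕜 : Type*) [RCLike 𝕜] {X : Type*} [NormedAddCommGroup X] [NormedSpace 𝕜 X]
  {Y : Type*} [NormedAddCommGroup Y] [NormedSpace 𝕜 Y]

/-- The closed linear span `[x_n : n ∈ ℕ]`. -/
def closedSpan (x : ℕ → X) : Submodule 𝕜 X := (Submodule.span 𝕜 (Set.range x)).topologicalClosure

theorem mem_closedSpan (x : ℕ → X) (n : ℕ) : x n ∈ closedSpan 𝕜 x :=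
  Submodule.le_topologicalClosure _ (Submodule.subset_span ⟨n, rfl⟩)

/-- `x` is a Schauder basis of its closed linear span. -/
def IsBasicSequence (x : ℕ → X) : Prop :=
  ∃ b : SchauderBasis 𝕜 (closedSpan 𝕜 x), ∀ n, (b n : X) = x n

/-- Every rearrangement of `x` is a basic sequence. -/
def IsUnconditionalBasicSequence (x : ℕ → X) : Prop :=
  ∀ π : Equiv.Perm ℕ, IsBasicSequence 𝕜 fun n => x (π n)

/-- Equivalence of sequences: an isomorphism of the closed linear spans maps `x n` to `y n`. -/
def EquivalentSequences (x : ℕ → X) (y : ℕ → Y) : Prop :=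
  ∃ T : closedSpan 𝕜 x ≃L[𝕜] closedSpan 𝕜 y,
    ∀ n, (T ⟨x n, mem_closedSpan 𝕜 x n⟩ : Y) = y n

/-- Congruence of sequences: an automorphism of the whole space maps `x n` to `y n`. -/
def CongruentSequences (x y : ℕ → X) : Prop := ∃ S : X ≃L[𝕜] X, ∀ n, S (x n) = y n

/-- The unit vector system of `ℓ₂`. -/
noncomputable def unitVectorL2 (n : ℕ) : lp (fun _ : ℕ => 𝕜) 2 := lp.single 2 n 1

end Sequences

/-- `0 < inf ‖x n‖ ≤ sup ‖x n‖ < ∞`. -/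
def IsSemiNormalized {X : Type*} [NormedAddCommGroup X] (x : ℕ → X) : Prop :=
  ∃ a b : ℝ, 0 < a ∧ ∀ n, a ≤ ‖x n‖ ∧ ‖x n‖ ≤ b

/-- Rademacher type `p`: the average of `‖∑ ± x i‖` over all choices of signs is at most
`C (∑ ‖x i‖ ^ p) ^ (1 / p)`. (By Kahane's inequality, averaging a power of the norm instead
gives the same notion.) -/
def HasRademacherType (X : Type*) [NormedAddCommGroup X] (p : ℝ) : Prop :=
  ∃ C : ℝ, ∀ (n : ℕ) (x : Fin n → X),
    (∑ ε : Fin n → ℤˣ, ‖∑ i, (ε i : ℤ) • x i‖) / 2 ^ n ≤ C * (∑ i, ‖x i‖ ^ p) ^ (1 / p)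

section Functions

variable {Ω : Type*} [MeasurableSpace Ω] {μ : Measure Ω} {𝕜 : Type*} [RCLike 𝕜]

/-- The terms of the sequence have pairwise disjoint supports, modulo null sets. -/
def DisjointlySupported (f : ℕ → Ω →ₘ[μ] 𝕜) : Prop :=
  Pairwise fun m n => ∀ᵐ ω ∂μ, f m ω = 0 ∨ f n ω = 0

/-- The class `f` contains a simple function. -/
def IsSimple (f : Ω →ₘ[μ] 𝕜) : Prop := ∃ s : SimpleFunc Ω 𝕜, f =ᵐ[μ] s

/-- `ess inf {|f n ω| : ω ∈ supp (f n)}` tends to infinity. -/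
def EscapesToInfinity (f : ℕ → Ω →ₘ[μ] 𝕜) : Prop :=
  Tendsto (fun n => essInf (fun ω => ‖f n ω‖ₑ) (μ.restrict (Function.support (f n))))
    atTop (𝓝 ∞)

end Functions

/-! This is the Kadec–Pełczyński dichotomy, with the inclusion of `L_ρ` into `L₂` as the comparison
map.

If the `L₂` norms stay away from zero, `Ψ` satisfies upper and lower `2`-estimates. Unconditionality
allows signs to be changed at a fixed cost. Averaging over signs and using type `2` gives the upper
estimate (`HasRademacherType.exists_norm_sum_le`). For the lower one, the inclusion into `L₂` is
bounded by the closed graph theorem, and in a Hilbert space some choice of signs makes the norm of a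
sum at least its value for orthogonal summands (`exists_signs_sum_sq_norm_le`).

If the infimum is zero, a subsequence tends to zero in `L₂`, hence in measure. Type `2` makes the
norm absolutely continuous: otherwise one function would have infinitely many disjoint pieces of
norm at least `ε`, and Rademacher-like functions built on them would behave as in `ℓ_∞`
(`exists_norm_restrict_lt`). So truncations at a fixed height become negligible
(`eventually_norm_sub_restrict_levelSet_le`), and the mass of the functions sits on high level sets
of tiny measure. Removing the later level sets from the earlier ones and approximating by simple
functions gives a disjoint sequence so close to the subsequence that a Neumann series provides the
automorphism (`congruentSequences_of_tsum_lt_one`). -/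

/-! ### Rearrangements and bounded finite sums -/

section Rearrangement

/-- If blocks `A k ⊆ [m k, m (k + 1))` are given, there is a rearrangement of `ℕ` in which each
block `A k` consists of consecutive terms, arbitrarily far away. -/
theorem exists_perm_consecutive_blocks (m : ℕ → ℕ) (hm0 : m 0 = 0) (hm : StrictMono m)
    (A : ℕ → Finset ℕ) (hA : ∀ k, ∀ i ∈ A k, m k ≤ i ∧ i < m (k + 1)) :
    ∃ π : Equiv.Perm ℕ, ∀ N, ∃ k p q, N ≤ p ∧ N ≤ q ∧
      (Finset.range q).image π = (Finset.range p).image π ∪ A k ∧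
      Disjoint ((Finset.range p).image π) (A k) := by
  classical
  have hblock : ∀ n, ∃ k, m k ≤ n ∧ n < m (k + 1) := by
    intro n
    induction n with
    | zero => exact ⟨0, hm0.le, by have := hm Nat.zero_lt_one; simpa [hm0] using this⟩
    | succ n ih =>
      obtain ⟨k, h1, h2⟩ := ih
      by_cases h : n + 1 < m (k + 1)
      · exact ⟨k, by omega, h⟩
      · exact ⟨k + 1, by omega, by have := hm (Nat.lt_add_one (k + 1)); omega⟩
  choose b hb1 hb2 using hblock
  -- A sorting key. The `k`-th interval receives keys in `[2 m k, 2 m (k + 1))`; the elements of `A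
  -- k` fall below `m k + m (k + 1)` and the others at or above it.
  set κ : ℕ → ℕ := fun n => if n ∈ A (b n) then m (b n) + n else m (b n + 1) + n with hκ
  have hlow : ∀ n, 2 * m (b n) ≤ κ n := by
    intro n
    have h1 := hb1 n
    have h2 := hb2 n
    simp only [hκ]
    split_ifs <;> omega
  have hup : ∀ n, κ n < 2 * m (b n + 1) := by
    intro n
    have h1 := hb1 n
    have h2 := hb2 n
    simp only [hκ]
    split_ifs <;> omega
  have hbeq : ∀ n k, 2 * m k ≤ κ n → κ n < 2 * m (k + 1) → b n = k := by
    intro n k h1 h2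
    have h3 := hlow n
    have h4 := hup n
    rcases lt_trichotomy (b n) k with h | h | h
    · have := hm.monotone (Nat.succ_le_of_lt h)
      simp only [Nat.succ_eq_add_one] at this
      omega
    · exact h
    · have := hm.monotone (Nat.succ_le_of_lt h)
      simp only [Nat.succ_eq_add_one] at this
      omega
  have hinj : Function.Injective κ := by
    intro x y hxy
    have hxy' : b x = b y := hbeq x (b y) (hxy ▸ hlow y) (hxy ▸ hup y)
    have h1 := hb1 x
    have h2 := hb2 x
    have h3 := hb1 y
    have h4 := hb2 y
    simp only [hκ] at hxy
    rw [hxy'] at hxy h1 h2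
    split_ifs at hxy <;> omega
  have : Infinite (Set.range κ) := (Set.infinite_range_of_injective hinj).to_subtype
  let e := Nat.Subtype.orderIsoOfNat (Set.range κ)
  -- `π i` is the integer with the `i`-th smallest key.
  let π : Equiv.Perm ℕ := e.toEquiv.trans (Equiv.ofInjective κ hinj).symm
  have hπ : ∀ i, κ (π i) = (e i : ℕ) := fun i => by
    have : (Equiv.ofInjective κ hinj) (π i) = e i := by simp [π]
    rw [← this]
    rfl
  have hmono : StrictMono fun i => κ (π i) := by
    intro i j hij
    simp only [hπ]
    exact e.strictMono hij
  have hcut : ∀ t, ∃ N, (∀ i, i < N ↔ κ (π i) < t) := by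
    intro t
    have hex : ∃ N, t ≤ κ (π N) := ⟨t, hmono.le_apply⟩
    refine ⟨Nat.find hex, fun i => ?_⟩
    rw [Nat.lt_find_iff]
    constructor
    · intro h
      exact not_le.1 (h i le_rfl)
    · intro h j hj
      exact not_le.2 ((hmono.monotone hj).trans_lt h)
  choose c hc using hcut
  have himg : ∀ t n, n ∈ (Finset.range (c t)).image π ↔ κ n < t := by
    intro t n
    simp only [Finset.mem_image, Finset.mem_range]
    constructor
    · rintro ⟨i, hi, rfl⟩
      exact (hc t i).1 hi
    · intro h
      exact ⟨π.symm n, (hc t _).2 (by simpa using h), by simp⟩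
  refine ⟨π, fun N => ?_⟩
  -- Since `k ≤ m k`, the key of `π N` lies below both cuts `2 m k` and `m k + m (k + 1)`, between
  -- which exactly the keys of `A k` lie.
  set k := κ (π N) + 1 with hk
  have hkm : κ (π N) < m k := lt_of_lt_of_le (Nat.lt_succ_self _) hm.le_apply
  have hmk := hm (Nat.lt_succ_self k)
  have hAb : ∀ n ∈ A k, b n = k := by
    intro n hn
    have h1 := hA k n hn
    have h3 := hb1 n
    have h4 := hb2 n
    rcases lt_trichotomy (b n) k with h | h | h
    · have := hm.monotone (Nat.succ_le_of_lt h)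
      simp only [Nat.succ_eq_add_one] at this
      omega
    · exact h
    · have := hm.monotone (Nat.succ_le_of_lt h)
      simp only [Nat.succ_eq_add_one] at this
      omega
  have hAκ : ∀ n ∈ A k, κ n = m k + n := by
    intro n hn
    simp only [hκ, hAb n hn, if_pos hn]
  simp only [Nat.succ_eq_add_one] at hmk
  refine ⟨k, c (2 * m k), c (m k + m (k + 1)), ((hc _ N).2 (by omega)).le,
    ((hc _ N).2 (by omega)).le, ?_, ?_⟩
  · ext n
    rw [Finset.mem_union, himg, himg]
    constructor
    · intro h
      by_cases h2 : κ n < 2 * m k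
      · exact Or.inl h2
      · right
        have hbn := hbeq n k (by omega) (by omega)
        by_contra hn
        have h3 := hb1 n
        simp only [hκ, hbn, if_neg hn] at h
        rw [hbn] at h3
        omega
    · rintro (h | h)
      · omega
      · have := hA k n h
        rw [hAκ n h]
        omega
  · rw [Finset.disjoint_left]
    intro n hn hn'
    rw [himg, hAκ n hn'] at hn
    have := hA k n hn'
    omega

/-- If the finite sums were unbounded, discarding the first `m` indices would leave finite sets
beyond `m` with sums of norm at least `1`. A rearrangement listing infinitely many such sets
consecutively violates the Cauchy condition. -/
theorem exists_norm_sum_le_of_forall_perm_cauchySeq {E : Type*} [SeminormedAddCommGroup E]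
    (v : ℕ → E) (h : ∀ π : Equiv.Perm ℕ, CauchySeq fun n => ∑ i ∈ Finset.range n, v (π i)) :
    ∃ B : ℝ, ∀ F : Finset ℕ, ‖∑ i ∈ F, v i‖ ≤ B := by
  classical
  by_contra! hcon
  have hG : ∀ m : ℕ, ∃ G : Finset ℕ, (∀ i ∈ G, m ≤ i) ∧ 1 ≤ ‖∑ i ∈ G, v i‖ := by
    intro m
    obtain ⟨F, hF⟩ := hcon (∑ i ∈ Finset.range m, ‖v i‖ + 1)
    refine ⟨F.filter fun i => ¬ i < m, fun i hi => by simpa using (Finset.mem_filter.1 hi).2, ?_⟩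
    have h1 := Finset.sum_filter_add_sum_filter_not F (fun i => i < m) v
    have h2 : ‖∑ i ∈ F.filter (fun i => i < m), v i‖ ≤ ∑ i ∈ Finset.range m, ‖v i‖ :=
      (norm_sum_le _ _).trans (Finset.sum_le_sum_of_subset_of_nonneg
        (fun i hi => Finset.mem_range.2 (Finset.mem_filter.1 hi).2) fun _ _ _ => norm_nonneg _)
    have h3 := norm_add_le (∑ i ∈ F.filter (fun i => i < m), v i)
      (∑ i ∈ F.filter (fun i => ¬ i < m), v i)
    rw [h1] at h3
    linarith
  choose G hG1 hG2 using hG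
  -- Each `m (k + 1)` is taken beyond all of `G (m k)`, so these sets occupy successive intervals.
  let m : ℕ → ℕ := fun k => Nat.rec 0 (fun _ r => max r ((G r).sup id) + 1) k
  have hms : ∀ k, m (k + 1) = max (m k) ((G (m k)).sup id) + 1 := fun k => rfl
  have hm : StrictMono m := strictMono_nat_of_lt_succ fun k => by
    rw [hms]
    exact Nat.lt_succ_of_le (le_max_left _ _)
  obtain ⟨π, hπ⟩ := exists_perm_consecutive_blocks m rfl hm (fun k => G (m k)) fun k i hi =>
    ⟨hG1 _ i hi, by
      rw [hms]
      exact Nat.lt_succ_of_le ((Finset.le_sup (f := id) hi).trans (le_max_right _ _))⟩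
  obtain ⟨N, hN⟩ := Metric.cauchySeq_iff.1 (h π) 1 one_pos
  obtain ⟨k, p, q, hp, hq, himg, hdisj⟩ := hπ N
  have hsum : ∀ r, ∑ i ∈ Finset.range r, v (π i) = ∑ i ∈ (Finset.range r).image π, v i :=
    fun r => (Finset.sum_image (fun a _ b _ hab => π.injective hab)).symm
  have h1 := hN q hq p hp
  rw [dist_eq_norm, hsum, hsum, himg, Finset.sum_union hdisj, add_sub_cancel_left] at h1
  exact absurd (hG2 (m k)) (not_le.2 h1)

end Rearrangement

/-! ### Basic sequences, perturbation, and equivalence with `ℓ₂` -/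

section BasicSequences

variable {𝕜 : Type*} [RCLike 𝕜] {X : Type*} [NormedAddCommGroup X] [NormedSpace 𝕜 X]

theorem tendsto_sum_range_of_hasSum_conditional {E : Type*} [AddCommMonoid E] [TopologicalSpace E]
    {f : ℕ → E} {y : E} (h : HasSum f y (SummationFilter.conditional ℕ)) :
    Tendsto (fun n => ∑ i ∈ Finset.range n, f i) atTop (𝓝 y) := by
  rw [HasSum, SummationFilter.conditional_filter_eq_map_range, tendsto_map'_iff] at h
  exact h

/-- The coordinate functionals of a basic sequence, extended to the whole space. -/
theorem IsBasicSequence.exists_coord {x : ℕ → X} (hx : IsBasicSequence 𝕜 x) :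
    ∃ g : ℕ → StrongDual 𝕜 X, (∀ i j, g i (x j) = if i = j then 1 else 0) ∧
      (∀ y ∈ closedSpan 𝕜 x,
        Tendsto (fun n => ∑ i ∈ Finset.range n, g i y • x i) atTop (𝓝 y)) ∧
      ∀ i, ∀ C : ℝ, 0 ≤ C → (∀ y ∈ closedSpan 𝕜 x, ‖g i y‖ ≤ C * ‖y‖) → ‖g i‖ ≤ C := by
  obtain ⟨b, hb⟩ := hx
  -- The Hahn–Banach extensions preserve norms, so bounds tested on the closed span pass to the
  -- whole space.
  choose g hg hgn using fun i => exists_extension_norm_eq (closedSpan 𝕜 x) (b.coord i)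
  refine ⟨g, fun i j => ?_, fun y hy => ?_, fun i C hC h => ?_⟩
  · rw [← hb j, hg, b.ortho]
    simp [Pi.single_apply]
  · have h1 := tendsto_sum_range_of_hasSum_conditional (b.expansion ⟨y, hy⟩)
    have h2 := ((closedSpan 𝕜 x).subtypeL.continuous.tendsto _).comp h1
    refine h2.congr fun n => ?_
    simp [← hg, hb]
  · rw [hgn]
    refine ContinuousLinearMap.opNorm_le_bound _ hC fun y => ?_
    rw [← hg]
    exact h y y.2

/-- The coordinate functionals of a basic sequence that is bounded away from zero are
uniformly bounded. -/
theorem IsBasicSequence.exists_bounded_coord [CompleteSpace X] {x : ℕ → X}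
    (hx : IsBasicSequence 𝕜 x) {a : ℝ} (ha : 0 < a) (hax : ∀ n, a ≤ ‖x n‖) :
    ∃ (g : ℕ → StrongDual 𝕜 X) (M : ℝ), (∀ i j, g i (x j) = if i = j then 1 else 0) ∧
      (∀ y ∈ closedSpan 𝕜 x,
        Tendsto (fun n => ∑ i ∈ Finset.range n, g i y • x i) atTop (𝓝 y)) ∧
      ∀ i, ‖g i‖ ≤ M := by
  obtain ⟨g, hg1, hg2, hg3⟩ := hx.exists_coord
  have : CompleteSpace (closedSpan 𝕜 x) := Submodule.topologicalClosure.completeSpace _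
  obtain ⟨M, hM⟩ := banach_steinhaus (g := fun i => (g i).comp (closedSpan 𝕜 x).subtypeL) (by
    rintro ⟨y, hy⟩
    obtain ⟨B, hB⟩ := (Metric.isBounded_range_of_tendsto _ (hg2 y hy)).exists_norm_le
    have hB' : ∀ n, ‖∑ i ∈ Finset.range n, g i y • x i‖ ≤ B := fun n => hB _ ⟨n, rfl⟩
    refine ⟨(B + B) / a, fun i => ?_⟩
    -- A term is the difference of two partial sums, which are bounded for fixed `y`; dividing by `a
    -- ≤ ‖x i‖` gives the pointwise bound for Banach–Steinhaus.
    have h1 : g i y • x i =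
        ∑ j ∈ Finset.range (i + 1), g j y • x j - ∑ j ∈ Finset.range i, g j y • x j := by
      rw [Finset.sum_range_succ, add_sub_cancel_left]
    have h2 : ‖g i y • x i‖ ≤ B + B := by
      rw [h1]
      exact (norm_sub_le _ _).trans (add_le_add (hB' _) (hB' _))
    rw [norm_smul] at h2
    rw [le_div_iff₀ ha]
    exact (mul_le_mul_of_nonneg_left (hax i) (norm_nonneg _)).trans h2)
  refine ⟨g, M, hg1, hg2, fun i => hg3 i M ((norm_nonneg _).trans (hM i)) fun y hy => ?_⟩
  exact ContinuousLinearMap.le_of_opNorm_le _ (hM i) (⟨y, hy⟩ : closedSpan 𝕜 x)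

/-- Uniform boundedness of the finite coordinate projections of an unconditional basic sequence,
tested on finite linear combinations. -/
theorem IsUnconditionalBasicSequence.exists_norm_sum_le [CompleteSpace X] {x : ℕ → X}
    (hx : IsUnconditionalBasicSequence 𝕜 x) :
    ∃ K : ℝ, 0 ≤ K ∧ ∀ (F G : Finset ℕ) (a : ℕ → 𝕜), F ⊆ G →
      ‖∑ i ∈ F, a i • x i‖ ≤ K * ‖∑ i ∈ G, a i • x i‖ := by
  classical
  obtain ⟨g, hg1, hg2, -⟩ := (hx 1).exists_coord
  have hspan : ∀ π : Equiv.Perm ℕ, closedSpan 𝕜 (fun n => x (π n)) = closedSpan 𝕜 x := by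
    intro π
    have : Set.range (fun n => x (π n)) = Set.range x := π.surjective.range_comp x
    rw [closedSpan, closedSpan, this]
  have hcauchy : ∀ y ∈ closedSpan 𝕜 x, ∀ π : Equiv.Perm ℕ,
      CauchySeq fun n => ∑ i ∈ Finset.range n, g (π i) y • x (π i) := by
    intro y hy π
    obtain ⟨g', hg1', hg2', -⟩ := (hx π).exists_coord
    -- The coordinates of the rearranged basis are the permuted ones, since continuous functionals
    -- agreeing on all `x j` agree on the closed span. Hence every rearrangement of the expansion of
    -- `y` converges.
    have heq : ∀ i, g' i y = g (π i) y := by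
      intro i
      refine ContinuousLinearMap.eqOn_closure_span (s := Set.range x) ?_ hy
      rintro _ ⟨j, rfl⟩
      have h1 := hg1' i (π.symm j)
      have h2 := hg1 (π i) j
      simp only [Equiv.apply_symm_apply] at h1
      simp only [Equiv.Perm.coe_one, id] at h2
      simp only [h1, h2, Equiv.eq_symm_apply]
    have h := hg2' y (by rw [hspan]; exact hy)
    simp only [heq] at h
    exact h.cauchySeq
  have : CompleteSpace (closedSpan 𝕜 x) := Submodule.topologicalClosure.completeSpace _
  -- Uniform boundedness is applied to the coordinate projections onto all finite sets at once.
  obtain ⟨K, hK⟩ := banach_steinhaus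
    (g := fun F : Finset ℕ => (∑ i ∈ F, (g i).smulRight (x i)).comp (closedSpan 𝕜 x).subtypeL) (by
    rintro ⟨y, hy⟩
    obtain ⟨B, hB⟩ := exists_norm_sum_le_of_forall_perm_cauchySeq (fun i => g i y • x i)
      (hcauchy y hy)
    exact ⟨B, fun F => by simpa using hB F⟩)
  refine ⟨K, (norm_nonneg _).trans (hK ∅), fun F G a hFG => ?_⟩
  have hy : ∑ i ∈ G, a i • x i ∈ closedSpan 𝕜 x :=
    Submodule.sum_mem _ fun i _ => Submodule.smul_mem _ _ (mem_closedSpan 𝕜 x i)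
  have h1 := ContinuousLinearMap.le_of_opNorm_le _ (hK F) (⟨_, hy⟩ : closedSpan 𝕜 x)
  have h2 : ∀ i ∈ F, g i (∑ j ∈ G, a j • x j) = a i := by
    intro i hi
    simp only [Equiv.Perm.coe_one, id] at hg1
    simp [map_sum, hg1, hFG hi]
  have h3 : (∑ i ∈ F, (g i).smulRight (x i)) (∑ j ∈ G, a j • x j) = ∑ i ∈ F, a i • x i := by
    rw [sum_apply]
    exact Finset.sum_congr rfl fun i hi => by rw [ContinuousLinearMap.smulRight_apply, h2 i hi]
  rw [ContinuousLinearMap.comp_apply, Submodule.subtypeL_apply, h3] at h1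
  exact h1

/-- Changes of signs are uniformly bounded on an unconditional basic sequence. -/
theorem IsUnconditionalBasicSequence.exists_norm_sign_sum_le [CompleteSpace X] {x : ℕ → X}
    (hx : IsUnconditionalBasicSequence 𝕜 x) :
    ∃ K : ℝ, 0 ≤ K ∧ ∀ (F : Finset ℕ) (a : ℕ → 𝕜) (ε : ℕ → ℤˣ),
      ‖∑ i ∈ F, (ε i : ℤ) • a i • x i‖ ≤ K * ‖∑ i ∈ F, a i • x i‖ := by
  classical
  obtain ⟨K, hK0, hK⟩ := hx.exists_norm_sum_le
  refine ⟨K + K, by positivity, fun F a ε => ?_⟩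
  have h1 : ∑ i ∈ F, (ε i : ℤ) • a i • x i =
      ∑ i ∈ F.filter (fun i => ε i = 1), a i • x i -
        ∑ i ∈ F.filter (fun i => ¬ ε i = 1), a i • x i := by
    rw [← Finset.sum_filter_add_sum_filter_not F (fun i => ε i = 1), sub_eq_add_neg,
      ← Finset.sum_neg_distrib]
    congr 1
    · refine Finset.sum_congr rfl fun i hi => ?_
      rw [(Finset.mem_filter.1 hi).2]
      simp
    · refine Finset.sum_congr rfl fun i hi => ?_
      rw [(Int.units_eq_one_or (ε i)).resolve_left (Finset.mem_filter.1 hi).2]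
      simp
  rw [h1, add_mul]
  exact (norm_sub_le _ _).trans (add_le_add (hK _ F a (Finset.filter_subset _ _))
    (hK _ F a (Finset.filter_subset _ _)))

/-- A small perturbation of a sequence that has bounded biorthogonal functionals is congruent
to it. -/
theorem congruentSequences_of_tsum_lt_one [CompleteSpace X] {x φ : ℕ → X}
    (g : ℕ → StrongDual 𝕜 X) (hg : ∀ i j, g i (x j) = if i = j then 1 else 0)
    {r : ℕ → ℝ} (hr : ∀ i, ‖g i‖ * ‖φ i - x i‖ ≤ r i) (hsum : Summable r) (hlt : ∑' i, r i < 1) :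
    CongruentSequences 𝕜 x φ := by
  classical
  -- The rank-one operators sum to `T` with `‖T‖ < 1`, and biorthogonality gives `T (x n) = x n - φ
  -- n`. So `1 - T` is invertible and maps `x n` to `φ n`.
  set A : ℕ → X →L[𝕜] X := fun i => (g i).smulRight (x i - φ i) with hA
  have hAn : ∀ i, ‖A i‖ ≤ r i := fun i => by
    rw [hA, ContinuousLinearMap.norm_smulRight_apply, norm_sub_rev]
    exact hr i
  obtain ⟨T, hT⟩ : Summable A := Summable.of_norm_bounded hsum hAn
  have hTn : ‖T‖ < 1 := by
    rw [← hT.tsum_eq]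
    exact (tsum_of_norm_bounded hsum.hasSum hAn).trans_lt hlt
  refine ⟨ContinuousLinearEquiv.unitsEquiv 𝕜 X (Units.oneSub T hTn), fun n => ?_⟩
  have h1 : T (x n) = x n - φ n := by
    have h2 : HasSum (fun i => A i (x n)) (T (x n)) :=
      hT.map (AddMonoidHom.mk' (fun S : X →L[𝕜] X => S (x n)) fun _ _ => rfl) (ContinuousEvalConst.continuous_eval_const (x n))
    have h3 : HasSum (fun i => A i (x n)) (A n (x n)) := hasSum_single n fun i hi => by
      simp [hA, hg, hi]
    rw [h2.unique h3]
    simp [hA, hg]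
  rw [ContinuousLinearEquiv.unitsEquiv_apply, Units.val_oneSub, sub_apply,
    one_apply_eq_self, h1, sub_sub_cancel]

/-- Signs can be chosen such that the norm of a sum in an inner product space is at least its
value for orthogonal summands. -/
theorem exists_signs_sum_sq_norm_le {ι H : Type*} [NormedAddCommGroup H] [InnerProductSpace 𝕜 H]
    (F : Finset ι) (x : ι → H) :
    ∃ ε : ι → ℤˣ, ∑ i ∈ F, ‖x i‖ ^ 2 ≤ ‖∑ i ∈ F, (ε i : ℤ) • x i‖ ^ 2 := by
  classical
  induction F using Finset.induction_on with
  | empty => exact ⟨1, by simp⟩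
  | insert j F hj ih =>
    obtain ⟨ε, hε⟩ := ih
    set s := ∑ i ∈ F, (ε i : ℤ) • x i with hs
    have hsum : ∀ u : ℤˣ, ∑ i ∈ F, (Function.update ε j u i : ℤ) • x i = s := fun u =>
      Finset.sum_congr rfl fun i hi => by
        rw [Function.update_of_ne (ne_of_mem_of_not_mem hi hj)]
    -- The sign of the new vector is chosen so that the cross term is nonnegative.
    rcases le_total 0 (RCLike.re (inner 𝕜 (x j) s)) with h | h
    · refine ⟨Function.update ε j 1, ?_⟩
      rw [Finset.sum_insert hj, Finset.sum_insert hj, hsum, Function.update_self, Units.val_one,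
        one_smul, norm_add_sq (𝕜 := 𝕜)]
      linarith
    · refine ⟨Function.update ε j (-1), ?_⟩
      rw [Finset.sum_insert hj, Finset.sum_insert hj, hsum, Function.update_self, Units.val_neg,
        Units.val_one, neg_smul, one_smul, neg_add_eq_sub, norm_sub_rev, norm_sub_sq (𝕜 := 𝕜)]
      linarith

theorem norm_sq_eq_tsum_of_lp_two (a : lp (fun _ : ℕ => 𝕜) 2) :
    HasSum (fun i => ‖a i‖ ^ 2) (‖a‖ ^ 2) := by
  have h := lp.hasSum_norm (p := 2) (by simp) a
  simpa using h

/-- A sequence with upper and lower `2`-estimates is equivalent to the unit vectors of `ℓ₂`. -/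
theorem equivalentSequences_unitVectorL2 [CompleteSpace X] {x : ℕ → X} {c C : ℝ} (hc : 0 < c)
    (hC : 0 ≤ C)
    (hup : ∀ (F : Finset ℕ) (a : ℕ → 𝕜), ‖∑ i ∈ F, a i • x i‖ ≤ C * √(∑ i ∈ F, ‖a i‖ ^ 2))
    (hlow : ∀ (F : Finset ℕ) (a : ℕ → 𝕜), c * √(∑ i ∈ F, ‖a i‖ ^ 2) ≤ ‖∑ i ∈ F, a i • x i‖) :
    EquivalentSequences 𝕜 x (unitVectorL2 𝕜) := by
  classical
  have hsummable : ∀ a : lp (fun _ : ℕ => 𝕜) 2, Summable fun i => a i • x i := by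
    intro a
    rw [summable_iff_vanishing_norm]
    intro ε hε
    -- The denominator is `C + 1` because `C` may be zero.
    obtain ⟨s, hs⟩ := summable_iff_vanishing_norm.1 (norm_sq_eq_tsum_of_lp_two a).summable
      ((ε / (C + 1)) ^ 2) (by positivity)
    refine ⟨s, fun t ht => (hup t a).trans_lt ?_⟩
    have h1 := (le_abs_self _).trans_lt (hs t ht)
    have h2 : √(∑ i ∈ t, ‖a i‖ ^ 2) < ε / (C + 1) := by
      rw [Real.sqrt_lt' (by positivity)]
      exact h1
    calc C * √(∑ i ∈ t, ‖a i‖ ^ 2) ≤ (C + 1) * √(∑ i ∈ t, ‖a i‖ ^ 2) := by gcongr; linarith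
      _ < (C + 1) * (ε / (C + 1)) := by gcongr
      _ = ε := by field_simp
  have hsqrt : ∀ a : lp (fun _ : ℕ => 𝕜) 2,
      Tendsto (fun F : Finset ℕ => √(∑ i ∈ F, ‖a i‖ ^ 2)) atTop (𝓝 ‖a‖) := fun a => by
    have h : Tendsto (fun F : Finset ℕ => ∑ i ∈ F, ‖a i‖ ^ 2) atTop (𝓝 (‖a‖ ^ 2)) :=
      norm_sq_eq_tsum_of_lp_two a
    have h2 := (Real.continuous_sqrt.tendsto _).comp h
    rwa [Real.sqrt_sq (norm_nonneg _)] at h2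
  have hnorm : ∀ a : lp (fun _ : ℕ => 𝕜) 2,
      Tendsto (fun F : Finset ℕ => ‖∑ i ∈ F, a i • x i‖) atTop (𝓝 ‖∑' i, a i • x i‖) :=
    fun a => (continuous_norm.tendsto _).comp (hsummable a).hasSum
  let T₀ : lp (fun _ : ℕ => 𝕜) 2 →ₗ[𝕜] X :=
    { toFun := fun a => ∑' i, a i • x i
      map_add' := fun a b => by
        rw [← (hsummable a).tsum_add (hsummable b)]
        simp [add_smul]
      map_smul' := fun r a => by
        rw [RingHom.id_apply, ← (hsummable a).tsum_const_smul]
        simp [mul_smul] }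
  let T : lp (fun _ : ℕ => 𝕜) 2 →L[𝕜] X := T₀.mkContinuous C fun a =>
    le_of_tendsto_of_tendsto' (hnorm a) ((hsqrt a).const_mul C) fun F => hup F a
  have hTlow : ∀ a, c * ‖a‖ ≤ ‖T a‖ := fun a =>
    le_of_tendsto_of_tendsto' ((hsqrt a).const_mul c) (hnorm a) fun F => hlow F a
  have hTe : ∀ n, T (unitVectorL2 𝕜 n) = x n := by
    intro n
    change ∑' i, (lp.single 2 n (1 : 𝕜) : lp (fun _ : ℕ => 𝕜) 2) i • x i = x n
    rw [tsum_eq_single n]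
    · simp
    · intro i hi
      rw [lp.single_apply_ne _ _ _ hi, zero_smul]
  have hTmem : ∀ a, T a ∈ closedSpan 𝕜 x := fun a => by
    refine (Submodule.isClosed_topologicalClosure _).mem_of_tendsto (hsummable a).hasSum
      (Eventually.of_forall fun F => ?_)
    exact Submodule.sum_mem (closedSpan 𝕜 x) fun i _ =>
      Submodule.smul_mem _ _ (mem_closedSpan 𝕜 x i)
  -- The lower estimate makes the range closed, so it contains the whole closed span and not only
  -- the finite combinations.
  have hanti : AntilipschitzWith (⟨c⁻¹, by positivity⟩ : ℝ≥0) T :=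
    AddMonoidHomClass.antilipschitz_of_bound T fun a => by
      change ‖a‖ ≤ c⁻¹ * ‖T a‖
      rw [inv_mul_eq_div, le_div_iff₀ hc, mul_comm]
      exact hTlow a
  have hclosed : IsClosed (T.toLinearMap.range : Set X) :=
    hanti.isClosed_range T.uniformContinuous
  have hrange : closedSpan 𝕜 x ≤ T.toLinearMap.range := by
    refine Submodule.topologicalClosure_minimal _ (Submodule.span_le.2 ?_) hclosed
    rintro _ ⟨n, rfl⟩
    exact ⟨_, hTe n⟩
  have htop : ∀ a, a ∈ closedSpan 𝕜 (unitVectorL2 𝕜) := fun a => by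
    refine (Submodule.isClosed_topologicalClosure _).mem_of_tendsto
      (lp.hasSum_single (p := 2) (by simp) a) (Eventually.of_forall fun F => ?_)
    refine Submodule.sum_mem (closedSpan 𝕜 (unitVectorL2 𝕜)) fun i _ => ?_
    have : (lp.single 2 i (a i) : lp (fun _ : ℕ => 𝕜) 2) = a i • unitVectorL2 𝕜 i := by
      rw [unitVectorL2, ← lp.single_smul, smul_eq_mul, mul_one]
    rw [this]
    exact Submodule.smul_mem _ _ (mem_closedSpan 𝕜 _ i)
  have : CompleteSpace (closedSpan 𝕜 x) := Submodule.topologicalClosure.completeSpace _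
  have : CompleteSpace (closedSpan 𝕜 (unitVectorL2 𝕜)) :=
    Submodule.topologicalClosure.completeSpace _
  let S : closedSpan 𝕜 (unitVectorL2 𝕜) →L[𝕜] closedSpan 𝕜 x :=
    (T.comp (closedSpan 𝕜 (unitVectorL2 𝕜)).subtypeL).codRestrict _ fun a => hTmem a
  have hker : S.toLinearMap.ker = ⊥ := by
    rw [LinearMap.ker_eq_bot]
    intro a b hab
    exact Subtype.ext (hanti.injective (congrArg Subtype.val hab))
  have hran : S.toLinearMap.range = ⊤ := by
    rw [LinearMap.range_eq_top]
    rintro ⟨y, hy⟩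
    obtain ⟨a, ha⟩ := hrange hy
    exact ⟨⟨a, htop a⟩, Subtype.ext ha⟩
  refine ⟨(ContinuousLinearEquiv.ofBijective S hker hran).symm, fun n => ?_⟩
  have h1 : ContinuousLinearEquiv.ofBijective S hker hran
      ⟨unitVectorL2 𝕜 n, mem_closedSpan 𝕜 _ n⟩ = ⟨x n, mem_closedSpan 𝕜 x n⟩ :=
    Subtype.ext (hTe n)
  rw [← h1, ContinuousLinearEquiv.symm_apply_apply]

end BasicSequences

theorem MeasureTheory.AEEqFun.coeFn_finset_sum {Ω ι E : Type*} [MeasurableSpace Ω] {μ : Measure Ω}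
    [AddCommMonoid E] [TopologicalSpace E] [ContinuousAdd E] (s : Finset ι) (f : ι → Ω →ₘ[μ] E) :
    ((∑ i ∈ s, f i : Ω →ₘ[μ] E) : Ω → E) =ᵐ[μ] fun ω => ∑ i ∈ s, f i ω := by
  classical
  induction s using Finset.induction_on with
  | empty =>
    filter_upwards [AEEqFun.coeFn_zero (α := Ω) (β := E) (μ := μ)] with ω h
    simpa using h
  | insert j s hj ih =>
    rw [Finset.sum_insert hj]
    filter_upwards [AEEqFun.coeFn_add (f j) (∑ i ∈ s, f i), ih] with ω h1 h2
    rw [h1, Pi.add_apply, h2, Finset.sum_insert hj]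

/-! ### Lattice properties of the norm and restriction to sets -/

namespace FunctionNorm

variable {Ω : Type*} [MeasurableSpace Ω] {μ : Measure Ω} (ρ : FunctionNorm μ)
  {𝕜 : Type*} [RCLike 𝕜]

theorem toFun_congr {f g : Ω → ℝ≥0∞} (hf : Measurable f) (hg : Measurable g) (h : f =ᵐ[μ] g) :
    ρ.toFun f = ρ.toFun g :=
  le_antisymm (ρ.mono _ _ hf hg h.le) (ρ.mono _ _ hg hf h.symm.le)

theorem toFun_sum_le {ι : Type*} (s : Finset ι) (f : ι → Ω → ℝ≥0∞) (hf : ∀ i, Measurable (f i)) :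
    ρ.toFun (fun ω => ∑ i ∈ s, f i ω) ≤ ∑ i ∈ s, ρ.toFun (f i) := by
  classical
  induction s using Finset.induction_on with
  | empty => simp only [Finset.sum_empty]; exact ((ρ.eq_zero_iff _ measurable_const).2 ae_eq_rfl).le
  | insert j s hj ih =>
    simp only [Finset.sum_insert hj]
    exact (ρ.add_le _ _ (hf j) (Finset.measurable_sum s fun i _ => hf i)).trans (by gcongr)

/-- Countable subadditivity of a function norm. -/
theorem toFun_tsum_le (f : ℕ → Ω → ℝ≥0∞) (hf : ∀ i, Measurable (f i)) :
    ρ.toFun (fun ω => ∑' i, f i ω) ≤ ∑' i, ρ.toFun (f i) := by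
  have h := ρ.fatou (fun n ω => ∑ i ∈ Finset.range n, f i ω) (fun ω => ∑' i, f i ω)
    (fun n => Finset.measurable_sum _ fun i _ => hf i) (Measurable.tsum hf)
    (Eventually.of_forall fun ω m n hmn =>
      Finset.sum_le_sum_of_subset (Finset.range_mono hmn))
    (Eventually.of_forall fun ω => ENNReal.tendsto_nat_tsum _)
  exact le_of_tendsto' h fun n => (ρ.toFun_sum_le _ f hf).trans (ENNReal.sum_le_tsum _)

theorem gauge_le_toFun {f : Ω →ₘ[μ] 𝕜} {g : Ω → ℝ≥0∞} (hg : Measurable g)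
    (h : ∀ᵐ ω ∂μ, ‖f ω‖ₑ ≤ g ω) : ρ.gauge f ≤ ρ.toFun g :=
  ρ.mono _ _ (measurable_enorm_coe f) hg h

theorem gauge_mono {f g : Ω →ₘ[μ] 𝕜} (h : ∀ᵐ ω ∂μ, ‖f ω‖ ≤ ‖g ω‖) : ρ.gauge f ≤ ρ.gauge g :=
  ρ.gauge_le_toFun (measurable_enorm_coe g) (h.mono fun _ h => enorm_le_iff_norm_le.2 h)

theorem ofReal_norm (f : ρ.space 𝕜) : ENNReal.ofReal ‖f‖ = ρ.gauge (f : Ω →ₘ[μ] 𝕜) := by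
  rw [norm_def, ENNReal.ofReal_toReal (ρ.gauge_coe_ne_top f)]

theorem norm_mono {f g : ρ.space 𝕜}
    (h : ∀ᵐ ω ∂μ, ‖(f : Ω →ₘ[μ] 𝕜) ω‖ ≤ ‖(g : Ω →ₘ[μ] 𝕜) ω‖) : ‖f‖ ≤ ‖g‖ := by
  rw [norm_def, norm_def]
  exact ENNReal.toReal_mono (ρ.gauge_coe_ne_top g) (ρ.gauge_mono h)

theorem norm_le_add_of_ae {f g h : ρ.space 𝕜}
    (hle : ∀ᵐ ω ∂μ, ‖(f : Ω →ₘ[μ] 𝕜) ω‖ ≤ ‖(g : Ω →ₘ[μ] 𝕜) ω‖ + ‖(h : Ω →ₘ[μ] 𝕜) ω‖) :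
    ‖f‖ ≤ ‖g‖ + ‖h‖ := by
  rw [norm_def, norm_def, norm_def,
    ← ENNReal.toReal_add (ρ.gauge_coe_ne_top g) (ρ.gauge_coe_ne_top h)]
  refine ENNReal.toReal_mono
    (ENNReal.add_ne_top.2 ⟨ρ.gauge_coe_ne_top g, ρ.gauge_coe_ne_top h⟩) ?_
  refine (ρ.gauge_le_toFun ((measurable_enorm_coe (g : Ω →ₘ[μ] 𝕜)).add
    (measurable_enorm_coe (h : Ω →ₘ[μ] 𝕜))) ?_).trans
    (ρ.add_le _ _ (measurable_enorm_coe _) (measurable_enorm_coe _))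
  filter_upwards [hle] with ω hω
  rw [Pi.add_apply, ← _root_.ofReal_norm, ← _root_.ofReal_norm, ← _root_.ofReal_norm,
    ← ENNReal.ofReal_add (norm_nonneg _) (norm_nonneg _)]
  exact ENNReal.ofReal_le_ofReal hω

section Restrict

/-- Multiplication by the indicator function of a measurable set. -/
noncomputable def restrict (E : Set Ω) (hE : MeasurableSet E) : ρ.space 𝕜 →ₗ[𝕜] ρ.space 𝕜 where
  toFun f := ⟨AEEqFun.mk (E.indicator (f : Ω →ₘ[μ] 𝕜))
    ((f : Ω →ₘ[μ] 𝕜).aestronglyMeasurable.indicator hE), by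
      refine lt_of_le_of_lt (ρ.gauge_mono ?_) f.2
      filter_upwards [AEEqFun.coeFn_mk (E.indicator (f : Ω →ₘ[μ] 𝕜))
        ((f : Ω →ₘ[μ] 𝕜).aestronglyMeasurable.indicator hE)] with ω h
      rw [h]
      exact norm_indicator_le_norm_self _ _⟩
  map_add' f g := by
    refine Subtype.ext (AEEqFun.ext ?_)
    refine (AEEqFun.coeFn_mk _ _).trans ?_
    filter_upwards [AEEqFun.coeFn_add (AEEqFun.mk (E.indicator (f : Ω →ₘ[μ] 𝕜))
        ((f : Ω →ₘ[μ] 𝕜).aestronglyMeasurable.indicator hE))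
        (AEEqFun.mk (E.indicator (g : Ω →ₘ[μ] 𝕜))
        ((g : Ω →ₘ[μ] 𝕜).aestronglyMeasurable.indicator hE)),
      AEEqFun.coeFn_mk (E.indicator (f : Ω →ₘ[μ] 𝕜))
        ((f : Ω →ₘ[μ] 𝕜).aestronglyMeasurable.indicator hE),
      AEEqFun.coeFn_mk (E.indicator (g : Ω →ₘ[μ] 𝕜))
        ((g : Ω →ₘ[μ] 𝕜).aestronglyMeasurable.indicator hE),
      AEEqFun.coeFn_add (f : Ω →ₘ[μ] 𝕜) (g : Ω →ₘ[μ] 𝕜)] with ω h1 h2 h3 h4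
    refine Eq.trans ?_ h1.symm
    rw [Pi.add_apply, h2, h3]
    by_cases hω : ω ∈ E
    · simp only [Set.indicator_of_mem hω]
      exact h4
    · simp only [Set.indicator_of_notMem hω, add_zero]
  map_smul' c f := by
    refine Subtype.ext (AEEqFun.ext ?_)
    refine (AEEqFun.coeFn_mk _ _).trans ?_
    filter_upwards [AEEqFun.coeFn_smul c (AEEqFun.mk (E.indicator (f : Ω →ₘ[μ] 𝕜))
        ((f : Ω →ₘ[μ] 𝕜).aestronglyMeasurable.indicator hE)),
      AEEqFun.coeFn_mk (E.indicator (f : Ω →ₘ[μ] 𝕜))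
        ((f : Ω →ₘ[μ] 𝕜).aestronglyMeasurable.indicator hE),
      AEEqFun.coeFn_smul c (f : Ω →ₘ[μ] 𝕜)] with ω h1 h2 h3
    refine Eq.trans ?_ h1.symm
    rw [Pi.smul_apply, h2]
    by_cases hω : ω ∈ E
    · simp only [Set.indicator_of_mem hω]
      exact h3
    · simp only [Set.indicator_of_notMem hω, smul_zero]

theorem coe_restrict {E : Set Ω} (hE : MeasurableSet E) (f : ρ.space 𝕜) :
    ((ρ.restrict E hE f : Ω →ₘ[μ] 𝕜) : Ω → 𝕜) =ᵐ[μ] E.indicator (f : Ω →ₘ[μ] 𝕜) :=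
  AEEqFun.coeFn_mk _ _

theorem space_ext {f g : ρ.space 𝕜}
    (h : ((f : Ω →ₘ[μ] 𝕜) : Ω → 𝕜) =ᵐ[μ] (g : Ω →ₘ[μ] 𝕜)) : f = g :=
  Subtype.ext (AEEqFun.ext h)

theorem norm_restrict_le {E : Set Ω} (hE : MeasurableSet E) (f : ρ.space 𝕜) :
    ‖ρ.restrict E hE f‖ ≤ ‖f‖ :=
  ρ.norm_mono <| by
    filter_upwards [ρ.coe_restrict hE f] with ω h
    rw [h]
    exact norm_indicator_le_norm_self _ _

theorem norm_restrict_mono {E F : Set Ω} (hE : MeasurableSet E) (hF : MeasurableSet F)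
    (hEF : E ⊆ F) (f : ρ.space 𝕜) : ‖ρ.restrict E hE f‖ ≤ ‖ρ.restrict F hF f‖ :=
  ρ.norm_mono <| by
    filter_upwards [ρ.coe_restrict hE f, ρ.coe_restrict hF f] with ω h1 h2
    rw [h1, h2]
    exact norm_indicator_le_of_subset hEF _ _

theorem restrict_restrict_self {E : Set Ω} (hE : MeasurableSet E) (f : ρ.space 𝕜) :
    ρ.restrict E hE (ρ.restrict E hE f) = ρ.restrict E hE f :=
  ρ.space_ext <| by
    filter_upwards [ρ.coe_restrict hE (ρ.restrict E hE f), ρ.coe_restrict hE f] with ω h1 h2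
    rw [h1]
    by_cases hω : ω ∈ E
    · rw [Set.indicator_of_mem hω]
    · rw [h2, Set.indicator_of_notMem hω, Set.indicator_of_notMem hω]

theorem restrict_restrict_of_disjoint {E F : Set Ω} (hE : MeasurableSet E) (hF : MeasurableSet F)
    (hEF : Disjoint E F) (f : ρ.space 𝕜) : ρ.restrict E hE (ρ.restrict F hF f) = 0 :=
  ρ.space_ext <| by
    filter_upwards [ρ.coe_restrict hE (ρ.restrict F hF f), ρ.coe_restrict hF f,
      AEEqFun.coeFn_zero (α := Ω) (β := 𝕜) (μ := μ)] with ω h1 h2 h3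
    rw [h1, Submodule.coe_zero, h3]
    by_cases hω : ω ∈ E
    · rw [Set.indicator_of_mem hω, h2, Set.indicator_of_notMem (Set.disjoint_left.1 hEF hω)]
      rfl
    · rw [Set.indicator_of_notMem hω]
      rfl

/-- By disjointness at most one summand is nonzero at each point, so the sum is dominated by `|f|`.
-/
theorem norm_sum_smul_restrict_le {ι : Type*} [Fintype ι] {D : ι → Set Ω}
    (hD : ∀ i, MeasurableSet (D i)) (hdisj : Pairwise fun i j => Disjoint (D i) (D j)) (c : ι → 𝕜)
    (hc : ∀ i, ‖c i‖ ≤ 1) (f : ρ.space 𝕜) :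
    ‖∑ i, c i • ρ.restrict (D i) (hD i) f‖ ≤ ‖f‖ := by
  classical
  refine ρ.norm_mono ?_
  have h1 : ∀ᵐ ω ∂μ, ∀ i, ((c i • ρ.restrict (D i) (hD i) f : ρ.space 𝕜) : Ω →ₘ[μ] 𝕜) ω =
      c i • (D i).indicator (f : Ω →ₘ[μ] 𝕜) ω := by
    rw [ae_all_iff]
    intro i
    rw [Submodule.coe_smul]
    filter_upwards [AEEqFun.coeFn_smul (c i) (ρ.restrict (D i) (hD i) f : Ω →ₘ[μ] 𝕜),
      ρ.coe_restrict (hD i) f] with ω h2 h3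
    rw [h2, Pi.smul_apply, h3]
  rw [Submodule.coe_sum]
  filter_upwards [AEEqFun.coeFn_finset_sum Finset.univ fun i =>
    ((c i • ρ.restrict (D i) (hD i) f : ρ.space 𝕜) : Ω →ₘ[μ] 𝕜), h1] with ω h2 h3
  rw [h2]
  simp only [h3]
  by_cases hω : ∃ i, ω ∈ D i
  · obtain ⟨i, hi⟩ := hω
    rw [Finset.sum_eq_single i, Set.indicator_of_mem hi, norm_smul]
    · exact mul_le_of_le_one_left (norm_nonneg _) (hc i)
    · intro j _ hj
      rw [Set.indicator_of_notMem (Set.disjoint_left.1 (hdisj hj.symm) hi), smul_zero]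
    · simp
  · push Not at hω
    rw [Finset.sum_eq_zero fun i _ => by rw [Set.indicator_of_notMem (hω i), smul_zero]]
    simp

end Restrict

/-! ### Type `2` forces absolute continuity of the norm -/

section OrderContinuity

/-- In a space of Rademacher type `2` the norms of the restrictions of a function to pairwise
disjoint sets are not bounded away from zero. -/
theorem exists_norm_restrict_lt (htype : HasRademacherType (ρ.space 𝕜) 2) (f : ρ.space 𝕜)
    {D : ℕ → Set Ω} (hD : ∀ k, MeasurableSet (D k))
    (hdisj : Pairwise fun i j => Disjoint (D i) (D j)) {ε : ℝ} (hε : 0 < ε) :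
    ∃ k, ‖ρ.restrict (D k) (hD k) f‖ < ε := by
  classical
  by_contra! hcon
  obtain ⟨C, hC⟩ := htype
  have key : ∀ n : ℕ, n * ε ≤ |C| * (√n * ‖f‖) := by
    intro n
    -- One of the disjoint sets is assigned to each of the `2 ^ n` sign patterns.
    let idx : (Fin n → ℤˣ) ↪ ℕ := (Fintype.equivFin _).toEmbedding.trans Fin.valEmbedding
    have hdisj' : Pairwise fun η ξ => Disjoint (D (idx η)) (D (idx ξ)) := fun η ξ h =>
      hdisj (idx.injective.ne h)
    set h : (Fin n → ℤˣ) → ρ.space 𝕜 := fun η => ρ.restrict (D (idx η)) (hD _) f with hh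
    -- Rademacher-like functions: on the set of the pattern `η`, `x i` is `η i` times `f`.
    set x : Fin n → ρ.space 𝕜 := fun i => ∑ η, (((η i : ℤˣ) : ℤ) : 𝕜) • h η with hx
    have hx1 : ∀ i, ‖x i‖ ≤ ‖f‖ := fun i =>
      ρ.norm_sum_smul_restrict_le (fun η => hD (idx η)) hdisj' _ (fun η => by
        rcases Int.units_eq_one_or (η i) with h | h <;> simp [h]) f
    -- On the set of the pattern `ξ` all signs match, and the signed sum equals `n` times `f`.
    have hx2 : ∀ ξ : Fin n → ℤˣ, n * ε ≤ ‖∑ i, (ξ i : ℤ) • x i‖ := by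
      intro ξ
      have h1 : ∀ i, ρ.restrict (D (idx ξ)) (hD _) (x i) = (((ξ i : ℤˣ) : ℤ) : 𝕜) • h ξ := by
        intro i
        rw [hx, map_sum, Finset.sum_eq_single ξ]
        · rw [map_smul, hh, restrict_restrict_self]
        · intro η _ hη
          rw [map_smul, hh, restrict_restrict_of_disjoint _ _ _ (hdisj' hη.symm), smul_zero]
        · simp
      have h2 : ρ.restrict (D (idx ξ)) (hD _) (∑ i, (ξ i : ℤ) • x i) = (n : 𝕜) • h ξ := by
        have h3 : ∀ i, (ξ i : ℤ) • ρ.restrict (D (idx ξ)) (hD _) (x i) = h ξ := by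
          intro i
          rw [h1]
          rcases Int.units_eq_one_or (ξ i) with h | h <;> simp [h]
        simp only [map_sum, map_zsmul, h3]
        rw [Finset.sum_const, Finset.card_univ, Fintype.card_fin, Nat.cast_smul_eq_nsmul]
      have h4 := ρ.norm_restrict_le (hD (idx ξ)) (∑ i, (ξ i : ℤ) • x i)
      rw [h2, norm_smul, RCLike.norm_natCast] at h4
      exact (mul_le_mul_of_nonneg_left (hcon _) (Nat.cast_nonneg n)).trans h4
    have h5 : n * ε ≤ (∑ ξ : Fin n → ℤˣ, ‖∑ i, (ξ i : ℤ) • x i‖) / 2 ^ n := by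
      rw [le_div_iff₀ (by positivity)]
      have h6 := Finset.card_nsmul_le_sum Finset.univ
        (fun ξ : Fin n → ℤˣ => ‖∑ i, (ξ i : ℤ) • x i‖) (n * ε) fun ξ _ => hx2 ξ
      have h7 : (Finset.univ : Finset (Fin n → ℤˣ)).card = 2 ^ n := by simp
      rw [h7, nsmul_eq_mul, Nat.cast_pow, Nat.cast_ofNat, mul_comm] at h6
      exact h6
    have h8 : (∑ i, ‖x i‖ ^ (2 : ℝ)) ^ (1 / (2 : ℝ)) ≤ √n * ‖f‖ := by
      rw [← Real.sqrt_eq_rpow]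
      refine Real.sqrt_le_iff.2 ⟨by positivity, ?_⟩
      rw [mul_pow, Real.sq_sqrt (Nat.cast_nonneg n)]
      calc ∑ i, ‖x i‖ ^ (2 : ℝ) ≤ ∑ _i : Fin n, ‖f‖ ^ 2 := Finset.sum_le_sum fun i _ => by
            rw [Real.rpow_two]
            exact pow_le_pow_left₀ (norm_nonneg _) (hx1 i) 2
        _ = n * ‖f‖ ^ 2 := by simp
    have h9 : 0 ≤ (∑ i, ‖x i‖ ^ (2 : ℝ)) ^ (1 / (2 : ℝ)) := by positivity
    calc n * ε ≤ _ := h5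
      _ ≤ C * (∑ i, ‖x i‖ ^ (2 : ℝ)) ^ (1 / (2 : ℝ)) := hC n x
      _ ≤ |C| * (∑ i, ‖x i‖ ^ (2 : ℝ)) ^ (1 / (2 : ℝ)) :=
        mul_le_mul_of_nonneg_right (le_abs_self C) h9
      _ ≤ _ := mul_le_mul_of_nonneg_left h8 (abs_nonneg C)
  -- The inequality `n ε ≤ |C| √n ‖f‖` fails for large `n`; a square `n = m ^ 2` removes the root.
  obtain ⟨m, hm⟩ := exists_nat_gt (|C| * ‖f‖ / ε)
  have h1 := key (m ^ 2)
  rw [div_lt_iff₀ hε] at hm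
  have hm0 : (0 : ℝ) < m := by
    by_contra hle
    have : (m : ℝ) = 0 := le_antisymm (not_lt.1 hle) (Nat.cast_nonneg m)
    rw [this, zero_mul] at hm
    exact absurd hm (not_lt.2 (by positivity))
  rw [Nat.cast_pow, Real.sqrt_sq hm0.le] at h1
  have h2 : (m : ℝ) * (|C| * ‖f‖) < m * (m * ε) := mul_lt_mul_of_pos_left hm hm0
  nlinarith

/-- The norm of the restriction to `B \ E m` recovers the norm of the restriction to `B` when
the sets `E m` decrease to a null set. -/
theorem tendsto_norm_restrict_diff (f : ρ.space 𝕜) {B : Set Ω} (hB : MeasurableSet B)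
    {E : ℕ → Set Ω} (hE : ∀ m, MeasurableSet (E m)) (hanti : Antitone E) (hnull : μ (⋂ m, E m) = 0) :
    Tendsto (fun m => ‖ρ.restrict (B \ E m) (hB.diff (hE m)) f‖) atTop
      (𝓝 ‖ρ.restrict B hB f‖) := by
  have hg := measurable_enorm_coe (f : Ω →ₘ[μ] 𝕜)
  have hgauge : ∀ {A : Set Ω} (hA : MeasurableSet A), ρ.gauge (ρ.restrict A hA f : Ω →ₘ[μ] 𝕜) =
      ρ.toFun (A.indicator fun ω => ‖(f : Ω →ₘ[μ] 𝕜) ω‖ₑ) := by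
    intro A hA
    refine ρ.toFun_congr (measurable_enorm_coe _) (hg.indicator hA) ?_
    filter_upwards [ρ.coe_restrict hA f] with ω h
    rw [h, enorm_indicator_eq_indicator_enorm]
  simp only [norm_def]
  refine (ENNReal.tendsto_toReal (ρ.gauge_coe_ne_top _)).comp ?_
  simp only [hgauge]
  -- The sets `B \ E m` increase to `B` up to a null set.
  refine ρ.fatou _ _ (fun m => hg.indicator (hB.diff (hE m))) (hg.indicator hB)
    (Eventually.of_forall fun ω m n hmn => ?_) ?_
  · exact Set.indicator_le_indicator_of_subset (Set.sdiff_subset_sdiff_right (hanti hmn))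
      (fun _ => zero_le) ω
  · have : ∀ᵐ ω ∂μ, ω ∉ ⋂ m, E m := measure_eq_zero_iff_ae_notMem.1 hnull
    filter_upwards [this] with ω hω
    simp only [Set.mem_iInter, not_forall] at hω
    obtain ⟨m, hm⟩ := hω
    refine tendsto_const_nhds.congr' ?_
    filter_upwards [eventually_ge_atTop m] with n hn
    have hn' : ω ∉ E n := fun h => hm (hanti hn h)
    by_cases hωB : ω ∈ B
    · rw [Set.indicator_of_mem hωB, Set.indicator_of_mem (Set.mem_sdiff_of_mem hωB hn')]
    · rw [Set.indicator_of_notMem hωB, Set.indicator_of_notMem fun h => hωB h.1]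

/-- Order continuity of the norm in the presence of type `2`. -/
theorem exists_norm_restrict_lt_of_antitone (htype : HasRademacherType (ρ.space 𝕜) 2)
    (f : ρ.space 𝕜) {B : ℕ → Set Ω} (hB : ∀ m, MeasurableSet (B m)) (hanti : Antitone B)
    (hnull : μ (⋂ m, B m) = 0) {ε : ℝ} (hε : 0 < ε) :
    ∃ m, ‖ρ.restrict (B m) (hB m) f‖ < ε := by
  by_contra! hcon
  -- If the norms on `B n` never drop below `ε`, some difference `B n \ B m` carries at least `ε /
  -- 2`. Iterating yields disjoint pieces with this bound.
  have hstep : ∀ n, ∃ m, n < m ∧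
      ε / 2 ≤ ‖ρ.restrict (B n \ B m) ((hB n).diff (hB m)) f‖ := by
    intro n
    have h1 := (ρ.tendsto_norm_restrict_diff f (hB n) hB hanti hnull).eventually_const_lt
      (lt_of_lt_of_le (half_lt_self hε) (hcon n))
    obtain ⟨m, hm1, hm2⟩ := (h1.and (eventually_gt_atTop n)).exists
    exact ⟨m, hm2, hm1.le⟩
  choose s hs1 hs2 using hstep
  let n : ℕ → ℕ := fun k => s^[k] 0
  have hn : ∀ k, n (k + 1) = s (n k) := fun k => Function.iterate_succ_apply' s k 0
  have hmono : StrictMono n := strictMono_nat_of_lt_succ fun k => by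
    rw [hn]
    exact hs1 _
  have hdisj : ∀ i j, i < j → Disjoint (B (n i) \ B (s (n i))) (B (n j) \ B (s (n j))) := by
    intro i j hij
    rw [Set.disjoint_left]
    intro ω h1 h2
    refine h1.2 (hanti ?_ h2.1)
    rw [← hn]
    exact hmono.monotone hij
  obtain ⟨k, hk⟩ := ρ.exists_norm_restrict_lt htype f
    (D := fun k => B (n k) \ B (s (n k))) (fun k => (hB _).diff (hB _))
    (fun i j hij => by
      rcases lt_or_gt_of_ne hij with h | h
      · exact hdisj i j h
      · exact (hdisj j i h).symm) (half_pos hε)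
  exact absurd (hs2 (n k)) (not_le.2 hk)

/-- Absolute continuity of the norm in the presence of type `2`. -/
theorem exists_forall_measure_le_norm_restrict_le (htype : HasRademacherType (ρ.space 𝕜) 2)
    (f : ρ.space 𝕜) {ε : ℝ} (hε : 0 < ε) :
    ∃ δ : ℝ≥0∞, 0 < δ ∧ ∀ (E : Set Ω) (hE : MeasurableSet E), μ E ≤ δ →
      ‖ρ.restrict E hE f‖ ≤ ε := by
  by_contra! hcon
  -- Bad sets of summable measure have a null limsup by Borel–Cantelli, while their tail unions
  -- decrease to it and keep the norm above `ε`.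
  obtain ⟨δ, hδ0, hδ⟩ := ENNReal.exists_pos_sum_of_countable' one_ne_zero ℕ
  choose E hE hE1 hE2 using fun n => hcon (δ n) (hδ0 n)
  have hlim : μ (limsup E atTop) = 0 :=
    measure_limsup_atTop_eq_zero
      (ne_top_of_le_ne_top ENNReal.one_ne_top ((ENNReal.tsum_le_tsum hE1).trans hδ.le))
  have hB : ∀ n, MeasurableSet (⋃ i, E (i + n)) := fun n => MeasurableSet.iUnion fun i => hE _
  obtain ⟨m, hm⟩ := ρ.exists_norm_restrict_lt_of_antitone htype f
    (B := fun n => ⋃ i, E (i + n)) hB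
    (fun a b hab => by
      refine Set.iUnion_subset fun i => ?_
      have : i + b = i + (b - a) + a := by omega
      rw [this]
      exact Set.subset_iUnion (fun i => E (i + a)) (i + (b - a)))
    (by rwa [limsup_eq_iInf_iSup_of_nat'] at hlim) hε
  refine absurd (ρ.norm_restrict_mono (hE m) (hB m) ?_ f) (not_le.2 (hm.trans (hE2 m)))
  simpa using Set.subset_iUnion (fun i => E (i + m)) 0

end OrderContinuity

/-! ### Completeness and boundedness of the inclusion into `L₂` -/

section Complete

variable [IsFiniteMeasure μ]

theorem exists_lintegral_le : ∃ C : ℝ≥0, ∀ f, Measurable f → ∫⁻ ω, f ω ∂μ ≤ C * ρ.toFun f := by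
  obtain ⟨C, hC⟩ := ρ.lintegral_le Set.univ MeasurableSet.univ (measure_lt_top _ _)
  exact ⟨C, fun f hf => by simpa using hC f hf⟩

/-- As in Riesz–Fischer: for an absolutely convergent series, countable subadditivity bounds the
gauge of the sum of absolute values, and the integral axiom makes that sum finite a.e. The pointwise
sum is the limit, with error at most the tail. -/
instance : CompleteSpace (ρ.space 𝕜) := by
  refine NormedAddCommGroup.completeSpace_of_summable_imp_tendsto fun u hu => ?_
  have hum : ∀ n, Measurable fun ω => ‖(u n : Ω →ₘ[μ] 𝕜) ω‖ₑ := fun n => measurable_enorm_coe _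
  have hfin : ∑' n, ρ.toFun (fun ω => ‖(u n : Ω →ₘ[μ] 𝕜) ω‖ₑ) ≠ ∞ := by
    have h1 : ∀ n, ρ.toFun (fun ω => ‖(u n : Ω →ₘ[μ] 𝕜) ω‖ₑ) = ENNReal.ofReal ‖u n‖ := fun n =>
      (ρ.ofReal_norm (u n)).symm
    simp only [h1]
    rw [← ENNReal.ofReal_tsum_of_nonneg (fun n => norm_nonneg _) hu]
    exact ENNReal.ofReal_ne_top
  have hGm : Measurable fun ω => ∑' n, ‖(u n : Ω →ₘ[μ] 𝕜) ω‖ₑ := Measurable.tsum hum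
  have hGfin : ∀ᵐ ω ∂μ, ∑' n, ‖(u n : Ω →ₘ[μ] 𝕜) ω‖ₑ < ∞ := by
    obtain ⟨C, hC⟩ := ρ.exists_lintegral_le
    refine ae_lt_top hGm (ne_top_of_le_ne_top ?_ (hC _ hGm))
    exact ENNReal.mul_ne_top ENNReal.coe_ne_top
      (ne_top_of_le_ne_top hfin (ρ.toFun_tsum_le _ hum))
  have hsum : ∀ᵐ ω ∂μ, Summable fun n => (u n : Ω →ₘ[μ] 𝕜) ω := by
    filter_upwards [hGfin] with ω hω
    refine Summable.of_norm ?_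
    simpa using ENNReal.summable_toReal hω.ne
  have hFm : AEStronglyMeasurable (fun ω => ∑' n, (u n : Ω →ₘ[μ] 𝕜) ω) μ := by
    refine aestronglyMeasurable_of_tendsto_ae atTop
      (f := fun N ω => ∑ n ∈ Finset.range N, (u n : Ω →ₘ[μ] 𝕜) ω) (fun N => ?_) ?_
    · exact Finset.aestronglyMeasurable_fun_sum _ fun n _ =>
        (u n : Ω →ₘ[μ] 𝕜).aestronglyMeasurable
    · filter_upwards [hsum] with ω hω
      exact hω.hasSum.tendsto_sum_nat
  set F : Ω →ₘ[μ] 𝕜 := AEEqFun.mk _ hFm with hF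
  have hFcoe : (F : Ω → 𝕜) =ᵐ[μ] fun ω => ∑' n, (u n : Ω →ₘ[μ] 𝕜) ω := AEEqFun.coeFn_mk _ _
  have hgauge : ∀ N, ρ.gauge (F - ((∑ n ∈ Finset.range N, u n : ρ.space 𝕜) : Ω →ₘ[μ] 𝕜)) ≤
      ∑' n, ρ.toFun (fun ω => ‖(u (n + N) : Ω →ₘ[μ] 𝕜) ω‖ₑ) := by
    intro N
    refine (ρ.gauge_le_toFun (g := fun ω => ∑' n, ‖(u (n + N) : Ω →ₘ[μ] 𝕜) ω‖ₑ)
      (Measurable.tsum fun n => hum _) ?_).trans (ρ.toFun_tsum_le _ fun n => hum _)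
    rw [Submodule.coe_sum]
    filter_upwards [AEEqFun.coeFn_sub F (∑ n ∈ Finset.range N, (u n : Ω →ₘ[μ] 𝕜)), hFcoe, hsum,
      AEEqFun.coeFn_finset_sum (Finset.range N) fun n => (u n : Ω →ₘ[μ] 𝕜)] with ω h1 h2 h3 h4
    rw [h1, Pi.sub_apply, h2, h4, ← h3.sum_add_tsum_nat_add N, add_sub_cancel_left]
    exact enorm_tsum_le_tsum_enorm
  have hFmem : F ∈ ρ.space 𝕜 := by
    have h := hgauge 0
    rw [Finset.sum_range_zero, Submodule.coe_zero, sub_zero] at h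
    exact h.trans_lt hfin.lt_top
  refine ⟨⟨F, hFmem⟩, ?_⟩
  rw [tendsto_iff_norm_sub_tendsto_zero]
  have h1 := (ENNReal.tendsto_toReal ENNReal.zero_ne_top).comp
    (ENNReal.tendsto_sum_nat_add _ hfin)
  refine squeeze_zero (fun N => norm_nonneg _) (fun N => ?_) h1
  rw [norm_sub_rev, norm_def]
  refine ENNReal.toReal_mono ?_ (hgauge N)
  exact ne_top_of_le_ne_top hfin (ENNReal.tsum_comp_le_tsum_of_injective (add_left_injective N) _)

/-- The inclusion into `L₂` as a linear map. -/
noncomputable def inclusionL2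
    (hL2 : (ρ.space 𝕜 : Set (Ω →ₘ[μ] 𝕜)) ⊆ (Lp 𝕜 2 μ : Set (Ω →ₘ[μ] 𝕜))) :
    ρ.space 𝕜 →ₗ[𝕜] Lp 𝕜 2 μ where
  toFun f := ⟨f, hL2 f.2⟩
  map_add' _ _ := Subtype.ext rfl
  map_smul' _ _ := Subtype.ext rfl

theorem tendstoInMeasure_of_tendsto {u : ℕ → ρ.space 𝕜} {x : ρ.space 𝕜}
    (hu : Tendsto u atTop (𝓝 x)) :
    TendstoInMeasure μ (fun n => ((u n : Ω →ₘ[μ] 𝕜) : Ω → 𝕜)) atTop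
      ((x : Ω →ₘ[μ] 𝕜) : Ω → 𝕜) := by
  refine tendstoInMeasure_of_tendsto_eLpNorm one_ne_zero
    (fun n => (u n : Ω →ₘ[μ] 𝕜).aestronglyMeasurable) (x : Ω →ₘ[μ] 𝕜).aestronglyMeasurable ?_
  obtain ⟨C, hC⟩ := ρ.exists_lintegral_le
  have h2 : Tendsto (fun n => C * ENNReal.ofReal ‖u n - x‖) atTop (𝓝 0) := by
    have h3 := ENNReal.tendsto_ofReal (tendsto_iff_norm_sub_tendsto_zero.1 hu)
    have h4 := ENNReal.Tendsto.const_mul (a := (C : ℝ≥0∞)) h3 (Or.inr ENNReal.coe_ne_top)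
    simpa using h4
  refine tendsto_of_tendsto_of_tendsto_of_le_of_le tendsto_const_nhds h2 (fun n => zero_le)
    fun n => ?_
  have h5 : ((u n - x : ρ.space 𝕜) : Ω →ₘ[μ] 𝕜) =ᵐ[μ] (u n : Ω →ₘ[μ] 𝕜) - (x : Ω →ₘ[μ] 𝕜) := by
    rw [Submodule.coe_sub]
    exact AEEqFun.coeFn_sub _ _
  rw [eLpNorm_one_eq_lintegral_enorm, ofReal_norm]
  refine le_trans (lintegral_congr_ae ?_).le (hC _ (measurable_enorm_coe _))
  filter_upwards [h5] with ω h
  rw [h]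

/-- Closed graph: convergence in either norm implies convergence in measure, whose limits are unique
a.e. -/
theorem continuous_inclusionL2
    (hL2 : (ρ.space 𝕜 : Set (Ω →ₘ[μ] 𝕜)) ⊆ (Lp 𝕜 2 μ : Set (Ω →ₘ[μ] 𝕜))) :
    Continuous (ρ.inclusionL2 hL2) :=
  LinearMap.continuous_of_seq_closed_graph _ fun _ _ _ hu hT =>
    Subtype.ext (AEEqFun.ext (tendstoInMeasure_ae_unique
      (tendstoInMeasure_of_tendsto_Lp hT) (ρ.tendstoInMeasure_of_tendsto hu)))

/-- The inclusion into `L₂` is bounded by the closed graph theorem. -/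
theorem exists_norm_inclusionL2_le
    (hL2 : (ρ.space 𝕜 : Set (Ω →ₘ[μ] 𝕜)) ⊆ (Lp 𝕜 2 μ : Set (Ω →ₘ[μ] 𝕜))) :
    ∃ C : ℝ, 0 < C ∧ ∀ f, ‖ρ.inclusionL2 hL2 f‖ ≤ C * ‖f‖ :=
  SemilinearMapClass.bound_of_continuous _ (ρ.continuous_inclusionL2 hL2)

end Complete

end FunctionNorm

/-! ### The upper `2`-estimate -/

section UpperEstimate

variable {𝕜 : Type*} [RCLike 𝕜] {X : Type*} [NormedAddCommGroup X] [NormedSpace 𝕜 X]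

theorem sum_equivFin_symm {E : Type*} [AddCommMonoid E] (F : Finset ℕ) (f : ℕ → E) :
    ∑ i : Fin F.card, f (F.equivFin.symm i) = ∑ i ∈ F, f i := by
  rw [Equiv.sum_comp F.equivFin.symm (fun i : F => f i), Finset.sum_coe_sort]

/-- In a space of type `2`, bounded sequences with bounded sign changes satisfy an upper
`2`-estimate. -/
theorem HasRademacherType.exists_norm_sum_le (htype : HasRademacherType X 2) {x : ℕ → X} {b K : ℝ}
    (hb : ∀ n, ‖x n‖ ≤ b) (hK0 : 0 ≤ K)
    (hK : ∀ (F : Finset ℕ) (a : ℕ → 𝕜) (ε : ℕ → ℤˣ),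
      ‖∑ i ∈ F, (ε i : ℤ) • a i • x i‖ ≤ K * ‖∑ i ∈ F, a i • x i‖) :
    ∃ C : ℝ, 0 ≤ C ∧ ∀ (F : Finset ℕ) (a : ℕ → 𝕜),
      ‖∑ i ∈ F, a i • x i‖ ≤ C * √(∑ i ∈ F, ‖a i‖ ^ 2) := by
  classical
  obtain ⟨C, hC⟩ := htype
  have hb0 : 0 ≤ b := (norm_nonneg _).trans (hb 0)
  refine ⟨K * (|C| * b), by positivity, fun F a => ?_⟩
  set n := F.card with hn
  let e : F ≃ Fin n := F.equivFin
  let y : Fin n → X := fun i => a (e.symm i) • x (e.symm i)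
  have h1 : ∀ η : Fin n → ℤˣ, ‖∑ i ∈ F, a i • x i‖ ≤ K * ‖∑ i, (η i : ℤ) • y i‖ := by
    intro η
    let ε : ℕ → ℤˣ := fun i => if h : i ∈ F then η (e ⟨i, h⟩) else 1
    have hε : ∀ i, ε (e.symm i) = η i := fun i => by simp [ε]
    -- The sign-change bound is applied to coefficients already carrying the signs. The signs square
    -- to one, so the unsigned sum is bounded by any signed one, and hence by their average.
    have h2 := hK F (fun i => (((ε i : ℤˣ) : ℤ) : 𝕜) * a i) ε
    have h3 : ∀ i, (ε i : ℤ) • ((((ε i : ℤˣ) : ℤ) : 𝕜) * a i) • x i = a i • x i := fun i => by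
      rcases Int.units_eq_one_or (ε i) with h | h <;> simp [h]
    have h4 : ∀ i, ((((ε i : ℤˣ) : ℤ) : 𝕜) * a i) • x i = (ε i : ℤ) • a i • x i := fun i => by
      rcases Int.units_eq_one_or (ε i) with h | h <;> simp [h]
    simp only [h3] at h2
    simp only [h4] at h2
    rw [← sum_equivFin_symm F fun i => (ε i : ℤ) • a i • x i] at h2
    have h6 : ∀ i, ε (F.equivFin.symm i) = η i := hε
    simpa only [h6] using h2
  have h5 : ‖∑ i ∈ F, a i • x i‖ ≤
      K * ((∑ η : Fin n → ℤˣ, ‖∑ i, (η i : ℤ) • y i‖) / 2 ^ n) := by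
    rw [← mul_div_assoc, le_div_iff₀ (by positivity), Finset.mul_sum]
    have h6 := Finset.card_nsmul_le_sum Finset.univ
      (fun η : Fin n → ℤˣ => K * ‖∑ i, (η i : ℤ) • y i‖) _ fun η _ => h1 η
    have h7 : (Finset.univ : Finset (Fin n → ℤˣ)).card = 2 ^ n := by simp
    rw [h7, nsmul_eq_mul, Nat.cast_pow, Nat.cast_ofNat, mul_comm] at h6
    exact h6
  have h8 : (∑ i, ‖y i‖ ^ (2 : ℝ)) ^ (1 / (2 : ℝ)) ≤ b * √(∑ i ∈ F, ‖a i‖ ^ 2) := by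
    rw [← Real.sqrt_eq_rpow]
    refine Real.sqrt_le_iff.2 ⟨by positivity, ?_⟩
    rw [mul_pow, Real.sq_sqrt (Finset.sum_nonneg fun _ _ => by positivity), Finset.mul_sum,
      ← sum_equivFin_symm]
    refine Finset.sum_le_sum fun i _ => ?_
    rw [Real.rpow_two, norm_smul, mul_comm, mul_pow]
    gcongr
    exact hb _
  have h9 : 0 ≤ (∑ i, ‖y i‖ ^ (2 : ℝ)) ^ (1 / (2 : ℝ)) := by positivity
  calc ‖∑ i ∈ F, a i • x i‖ ≤ _ := h5
    _ ≤ K * (C * (∑ i, ‖y i‖ ^ (2 : ℝ)) ^ (1 / (2 : ℝ))) :=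
      mul_le_mul_of_nonneg_left (hC n y) hK0
    _ ≤ K * (|C| * (b * √(∑ i ∈ F, ‖a i‖ ^ 2))) := by
      gcongr
      exact le_abs_self C
    _ = _ := by ring

end UpperEstimate

/-! ### Level sets, sequences null in `L₂`, and part (i) -/

namespace FunctionNorm

variable {Ω : Type*} [MeasurableSpace Ω] {μ : Measure Ω} (ρ : FunctionNorm μ)
  {𝕜 : Type*} [RCLike 𝕜]

theorem norm_ofReal_smul {c : ℝ} (hc : 0 ≤ c) (f : ρ.space 𝕜) : ‖(c : 𝕜) • f‖ = c * ‖f‖ := by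
  rw [norm_smul, RCLike.norm_ofReal, abs_of_nonneg hc]

/-- The set where `|f|` exceeds `t`. -/
def levelSet (f : Ω →ₘ[μ] 𝕜) (t : ℝ) : Set Ω := {ω | t < ‖f ω‖}

theorem measurableSet_levelSet (f : Ω →ₘ[μ] 𝕜) (t : ℝ) : MeasurableSet (levelSet f t) :=
  measurableSet_lt measurable_const f.stronglyMeasurable.norm.measurable

theorem tendsto_measure_levelSet
    (hL2 : (ρ.space 𝕜 : Set (Ω →ₘ[μ] 𝕜)) ⊆ (Lp 𝕜 2 μ : Set (Ω →ₘ[μ] 𝕜)))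
    {u : ℕ → ρ.space 𝕜} (hu : Tendsto (fun n => ρ.inclusionL2 hL2 (u n)) atTop (𝓝 0)) {t : ℝ}
    (ht : 0 < t) : Tendsto (fun n => μ (levelSet (u n : Ω →ₘ[μ] 𝕜) t)) atTop (𝓝 0) := by
  have h := tendstoInMeasure_of_tendsto_Lp hu (ENNReal.ofReal t) (by simpa using ht)
  refine tendsto_of_tendsto_of_tendsto_of_le_of_le tendsto_const_nhds h (fun n => zero_le)
    fun n => measure_mono_ae ?_
  filter_upwards [Lp.coeFn_zero 𝕜 2 μ] with ω hω hlt
  change ENNReal.ofReal t ≤ edist ((u n : Ω →ₘ[μ] 𝕜) ω) _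
  rw [hω, Pi.zero_apply, edist_zero_right, ← _root_.ofReal_norm]
  exact ENNReal.ofReal_le_ofReal (le_of_lt hlt)

/-- No term has `L₂` norm zero, so finitely many terms cannot account for the zero infimum:
infinitely many lie below every positive level. -/
theorem exists_strictMono_tendsto_inclusionL2
    (hL2 : (ρ.space 𝕜 : Set (Ω →ₘ[μ] 𝕜)) ⊆ (Lp 𝕜 2 μ : Set (Ω →ₘ[μ] 𝕜)))
    {ψ : ℕ → ρ.space 𝕜} (hne : ∀ n, ψ n ≠ 0)
    (hinf : (⨅ n, eLpNorm (ψ n : Ω →ₘ[μ] 𝕜) 2 μ) = 0) :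
    ∃ σ : ℕ → ℕ, StrictMono σ ∧
      Tendsto (fun i => ρ.inclusionL2 hL2 (ψ (σ i))) atTop (𝓝 0) := by
  have hpos : ∀ n, 0 < eLpNorm (ψ n : Ω →ₘ[μ] 𝕜) 2 μ := by
    intro n
    refine pos_iff_ne_zero.2 fun h => hne n ?_
    rw [eLpNorm_eq_zero_iff (ψ n : Ω →ₘ[μ] 𝕜).aestronglyMeasurable two_ne_zero] at h
    exact Subtype.ext (AEEqFun.ext (h.trans AEEqFun.coeFn_zero.symm))
  have hfreq : ∀ i : ℕ, ∃ᶠ n in atTop,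
      eLpNorm (ψ n : Ω →ₘ[μ] 𝕜) 2 μ < ENNReal.ofReal (1 / ((i : ℝ) + 1)) := by
    intro i h
    obtain ⟨N, hN⟩ := eventually_atTop.1 h
    have h1 : 0 < (Finset.range N).inf fun n => eLpNorm (ψ n : Ω →ₘ[μ] 𝕜) 2 μ :=
      (Finset.lt_inf_iff ENNReal.zero_lt_top).2 fun n _ => hpos n
    have h2 : 0 < ENNReal.ofReal (1 / ((i : ℝ) + 1)) := ENNReal.ofReal_pos.2 (by positivity)
    refine absurd hinf (lt_of_lt_of_le (lt_min h1 h2) (le_iInf fun n => ?_)).ne'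
    by_cases hn : n < N
    · exact (min_le_left _ _).trans (Finset.inf_le (Finset.mem_range.2 hn))
    · exact (min_le_right _ _).trans (not_lt.1 (hN n (not_lt.1 hn)))
  obtain ⟨σ, hσ, hlt⟩ := extraction_forall_of_frequently hfreq
  refine ⟨σ, hσ, squeeze_zero_norm (fun i => ?_) tendsto_one_div_add_atTop_nhds_zero_nat⟩
  rw [Lp.norm_def]
  exact (ENNReal.toReal_mono ENNReal.ofReal_ne_top (hlt i).le).trans_eq
    (ENNReal.toReal_ofReal (by positivity))

variable [IsFiniteMeasure μ]

theorem equivalentSequences_unitVectorL2_of_iInf_pos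
    (hL2 : (ρ.space 𝕜 : Set (Ω →ₘ[μ] 𝕜)) ⊆ (Lp 𝕜 2 μ : Set (Ω →ₘ[μ] 𝕜)))
    (htype : HasRademacherType (ρ.space 𝕜) 2)
    {ψ : ℕ → ρ.space 𝕜} (hsemi : IsSemiNormalized ψ)
    (hψ : IsUnconditionalBasicSequence 𝕜 ψ)
    (hpos : 0 < (⨅ n, eLpNorm (ψ n : Ω →ₘ[μ] 𝕜) 2 μ)) :
    EquivalentSequences 𝕜 ψ (unitVectorL2 𝕜) := by
  obtain ⟨K, hK0, hK⟩ := hψ.exists_norm_sign_sum_le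
  obtain ⟨a, b, -, hab⟩ := hsemi
  obtain ⟨C, hC0, hC⟩ := htype.exists_norm_sum_le (fun n => (hab n).2) hK0 hK
  obtain ⟨D, hD0, hD⟩ := ρ.exists_norm_inclusionL2_le hL2
  set T := ρ.inclusionL2 hL2 with hT
  have hfin : ∀ n, eLpNorm (ψ n : Ω →ₘ[μ] 𝕜) 2 μ ≠ ∞ := fun n => Lp.eLpNorm_ne_top (T (ψ n))
  set d := (⨅ n, eLpNorm (ψ n : Ω →ₘ[μ] 𝕜) 2 μ).toReal with hd
  have hd0 : 0 < d := ENNReal.toReal_pos hpos.ne' (ne_top_of_le_ne_top (hfin 0) (iInf_le _ 0))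
  have hdle : ∀ n, d ≤ ‖T (ψ n)‖ := fun n => by
    rw [Lp.norm_def]
    exact ENNReal.toReal_mono (hfin n) (iInf_le _ n)
  -- The constant combines `d`, the infimum in `L₂`, the norm bound `D` of the inclusion, and the
  -- sign-change cost `K`, enlarged to `K + 1` to keep the denominator positive.
  refine equivalentSequences_unitVectorL2 (c := d / (D * (K + 1))) (by positivity) hC0 hC
    fun F α => ?_
  obtain ⟨ε, hε⟩ := exists_signs_sum_sq_norm_le (𝕜 := 𝕜) F fun i => α i • T (ψ i)
  have h1 : ∑ i ∈ F, (ε i : ℤ) • α i • T (ψ i) = T (∑ i ∈ F, (ε i : ℤ) • α i • ψ i) := by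
    simp only [map_sum, map_zsmul, map_smul]
  have h2 : ‖T (∑ i ∈ F, (ε i : ℤ) • α i • ψ i)‖ ≤ D * ((K + 1) * ‖∑ i ∈ F, α i • ψ i‖) := by
    refine (hD _).trans (mul_le_mul_of_nonneg_left ((hK F α ε).trans ?_) hD0.le)
    gcongr
    linarith
  have h3 : d * √(∑ i ∈ F, ‖α i‖ ^ 2) ≤ ‖T (∑ i ∈ F, (ε i : ℤ) • α i • ψ i)‖ := by
    refine le_of_sq_le_sq ?_ (norm_nonneg _)
    rw [mul_pow, Real.sq_sqrt (Finset.sum_nonneg fun _ _ => by positivity), ← h1, Finset.mul_sum]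
    refine le_trans (Finset.sum_le_sum fun i _ => ?_) hε
    rw [norm_smul, mul_pow, mul_comm]
    gcongr
    exact hdle i
  rw [div_mul_eq_mul_div, div_le_iff₀ (by positivity)]
  calc d * √(∑ i ∈ F, ‖α i‖ ^ 2) ≤ _ := h3.trans h2
    _ = _ := by ring

/-! ### Truncation and approximation by simple functions -/

section SimpleFunctions

/-- The constant function `1`. -/
noncomputable def one : ρ.space 𝕜 :=
  ⟨AEEqFun.const Ω 1, by
    refine lt_of_le_of_lt (ρ.gauge_le_toFun (g := Set.univ.indicator 1)
      (measurable_one.indicator MeasurableSet.univ) ?_)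
      (ρ.indicator_lt_top _ MeasurableSet.univ (measure_lt_top _ _))
    filter_upwards [AEEqFun.coeFn_const (μ := μ) Ω (1 : 𝕜)] with ω h
    rw [h]
    simp⟩

theorem norm_smul_one_apply {c : ℝ} (hc : 0 ≤ c) :
    ∀ᵐ ω ∂μ, ‖(((c : 𝕜) • ρ.one : ρ.space 𝕜) : Ω →ₘ[μ] 𝕜) ω‖ = c := by
  rw [Submodule.coe_smul]
  filter_upwards [AEEqFun.coeFn_smul (c : 𝕜) ((ρ.one : ρ.space 𝕜) : Ω →ₘ[μ] 𝕜),
    AEEqFun.coeFn_const (μ := μ) Ω (1 : 𝕜)] with ω h1 h2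
  have h3 : ((ρ.one : ρ.space 𝕜) : Ω →ₘ[μ] 𝕜) ω = 1 := h2
  rw [h1, Pi.smul_apply, h3, norm_smul, norm_one, mul_one, RCLike.norm_ofReal, abs_of_nonneg hc]

theorem mk_simpleFunc_mem (s : SimpleFunc Ω 𝕜) :
    AEEqFun.mk s s.aestronglyMeasurable ∈ ρ.space 𝕜 := by
  obtain ⟨C, hC⟩ := s.exists_forall_norm_le
  refine lt_of_le_of_lt (ρ.gauge_mono ?_) (((max C 0 : ℝ) : 𝕜) • ρ.one : ρ.space 𝕜).2
  filter_upwards [ρ.norm_smul_one_apply (𝕜 := 𝕜) (le_max_right C 0),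
    AEEqFun.coeFn_mk (μ := μ) s s.aestronglyMeasurable] with ω h1 h2
  rw [h1, h2]
  exact (hC ω).trans (le_max_left _ _)

/-- If a sequence tends to zero in `L₂`, then its truncations at a fixed height tend to zero in
norm. -/
theorem eventually_norm_sub_restrict_levelSet_le (htype : HasRademacherType (ρ.space 𝕜) 2)
    (hL2 : (ρ.space 𝕜 : Set (Ω →ₘ[μ] 𝕜)) ⊆ (Lp 𝕜 2 μ : Set (Ω →ₘ[μ] 𝕜)))
    {u : ℕ → ρ.space 𝕜} (hu : Tendsto (fun n => ρ.inclusionL2 hL2 (u n)) atTop (𝓝 0)) {t : ℝ}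
    (ht : 0 < t) {ε : ℝ} (hε : 0 < ε) :
    ∀ᶠ n in atTop, ‖u n - ρ.restrict (levelSet (u n : Ω →ₘ[μ] 𝕜) t)
      (measurableSet_levelSet _ _) (u n)‖ ≤ ε := by
  set s : ℝ := ε / (2 * (‖(ρ.one : ρ.space 𝕜)‖ + 1)) with hs
  have hs0 : 0 < s := by positivity
  obtain ⟨δ, hδ0, hδ⟩ := ρ.exists_forall_measure_le_norm_restrict_le htype (ρ.one : ρ.space 𝕜)
    (ε := ε / (2 * t)) (by positivity)
  filter_upwards [(ρ.tendsto_measure_levelSet hL2 hu hs0).eventually_le_const hδ0] with n hn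
  set E := levelSet (u n : Ω →ₘ[μ] 𝕜) s with hE
  have hEm : MeasurableSet E := measurableSet_levelSet _ _
  -- Where `|u n| ≤ t`, the function is at most `s` off `E` and at most `t` on `E`. The first part
  -- is small by the choice of `s`, the second because `μ E` is small.
  have h1 : ‖u n - ρ.restrict (levelSet (u n : Ω →ₘ[μ] 𝕜) t) (measurableSet_levelSet _ _) (u n)‖ ≤
      ‖(s : 𝕜) • (ρ.one : ρ.space 𝕜)‖ +
        ‖ρ.restrict E hEm ((t : 𝕜) • (ρ.one : ρ.space 𝕜))‖ := by
    refine ρ.norm_le_add_of_ae ?_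
    rw [Submodule.coe_sub]
    filter_upwards [AEEqFun.coeFn_sub (u n : Ω →ₘ[μ] 𝕜) (ρ.restrict
        (levelSet (u n : Ω →ₘ[μ] 𝕜) t) (measurableSet_levelSet _ _) (u n) : Ω →ₘ[μ] 𝕜),
      ρ.coe_restrict (measurableSet_levelSet (u n : Ω →ₘ[μ] 𝕜) t) (u n),
      ρ.coe_restrict hEm ((t : 𝕜) • (ρ.one : ρ.space 𝕜)), ρ.norm_smul_one_apply (𝕜 := 𝕜) hs0.le,
      ρ.norm_smul_one_apply (𝕜 := 𝕜) ht.le] with ω h1 h2 h3 h4 h5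
    rw [h1, Pi.sub_apply, h2, h3, h4]
    by_cases ha : ω ∈ levelSet (u n : Ω →ₘ[μ] 𝕜) t
    · rw [Set.indicator_of_mem ha, sub_self, norm_zero]
      positivity
    · rw [Set.indicator_of_notMem ha, sub_zero]
      by_cases hb : ω ∈ E
      · rw [Set.indicator_of_mem hb, h5]
        have : ‖(u n : Ω →ₘ[μ] 𝕜) ω‖ ≤ t := not_lt.1 ha
        linarith
      · rw [Set.indicator_of_notMem hb, norm_zero, add_zero]
        exact not_lt.1 hb
  refine h1.trans ?_
  rw [map_smul, ρ.norm_ofReal_smul hs0.le, ρ.norm_ofReal_smul ht.le]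
  have h2 : t * ‖ρ.restrict E hEm (ρ.one : ρ.space 𝕜)‖ ≤ ε / 2 := by
    calc t * ‖ρ.restrict E hEm (ρ.one : ρ.space 𝕜)‖ ≤ t * (ε / (2 * t)) := by
          gcongr
          exact hδ E hEm hn
      _ = ε / 2 := by field_simp
  have h3 : s * ‖(ρ.one : ρ.space 𝕜)‖ ≤ ε / 2 := by
    calc s * ‖(ρ.one : ρ.space 𝕜)‖ ≤ s * (‖(ρ.one : ρ.space 𝕜)‖ + 1) := by gcongr; linarith
      _ = ε / 2 := by rw [hs]; field_simp
  linarith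

/-- Approximation in norm of the restriction of a function to a set by a simple function whose
absolute value is not much smaller on its support. -/
theorem exists_isSimple_norm_sub_restrict_le (htype : HasRademacherType (ρ.space 𝕜) 2)
    (f : ρ.space 𝕜) {E : Set Ω} (hE : MeasurableSet E) {ε η : ℝ} (hε : 0 < ε) (hη : 0 < η) :
    ∃ φ : ρ.space 𝕜, IsSimple (φ : Ω →ₘ[μ] 𝕜) ∧
      (∀ᵐ ω ∂μ, (φ : Ω →ₘ[μ] 𝕜) ω ≠ 0 → ω ∈ E) ∧
      (∀ᵐ ω ∂μ, (φ : Ω →ₘ[μ] 𝕜) ω ≠ 0 →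
        ‖(f : Ω →ₘ[μ] 𝕜) ω‖ - η ≤ ‖(φ : Ω →ₘ[μ] 𝕜) ω‖) ∧
      ‖φ - ρ.restrict E hE f‖ ≤ ε := by
  -- The bound `η` serves the pointwise estimate; the other makes `r` times the norm of `1` at most
  -- `ε / 2`.
  set r : ℝ := min η (ε / (2 * (‖(ρ.one : ρ.space 𝕜)‖ + 1))) with hr
  have hr0 : 0 < r := lt_min hη (by positivity)
  obtain ⟨δ, hδ0, hδ⟩ := ρ.exists_forall_measure_le_norm_restrict_le htype f
    (ε := ε / 2) (by positivity)
  have hfm := (f : Ω →ₘ[μ] 𝕜).stronglyMeasurable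
  have hlim := tendstoInMeasure_of_tendsto_ae (μ := μ)
    (fun n => (hfm.approx n).aestronglyMeasurable)
    (Eventually.of_forall hfm.tendsto_approx) (ENNReal.ofReal r) (by simpa using hr0)
  obtain ⟨n, hn⟩ := (hlim.eventually_le_const hδ0).exists
  set s := hfm.approx n with hs
  -- The set of bad approximation has small measure. The simple function is set to zero there, at a
  -- cost controlled by absolute continuity of the norm of `f`.
  set B : Set Ω := {ω | r ≤ ‖s ω - (f : Ω →ₘ[μ] 𝕜) ω‖} with hB
  have hBm : MeasurableSet B :=
    measurableSet_le measurable_const (s.stronglyMeasurable.sub hfm).norm.measurable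
  have hμB : μ B ≤ δ := by
    refine le_trans (measure_mono fun ω hω => ?_) hn
    change ENNReal.ofReal r ≤ edist (s ω) _
    rw [edist_eq_enorm_sub, ← _root_.ofReal_norm]
    exact ENNReal.ofReal_le_ofReal hω
  set σ : SimpleFunc Ω 𝕜 := s.restrict (E \ B) with hσ
  have hσ1 : ∀ ω, σ ω = (E \ B).indicator s ω := fun ω => by
    rw [hσ, SimpleFunc.restrict_apply _ (hE.diff hBm)]
  let φ : ρ.space 𝕜 := ⟨AEEqFun.mk σ σ.aestronglyMeasurable, ρ.mk_simpleFunc_mem σ⟩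
  have hφ : ((φ : Ω →ₘ[μ] 𝕜) : Ω → 𝕜) =ᵐ[μ] σ := AEEqFun.coeFn_mk _ _
  refine ⟨φ, ⟨σ, hφ⟩, ?_, ?_, ?_⟩
  · filter_upwards [hφ] with ω h hne
    rw [h, hσ1] at hne
    exact (Set.mem_of_indicator_ne_zero hne).1
  · filter_upwards [hφ] with ω h hne
    rw [h, hσ1] at hne
    have hmem := Set.mem_of_indicator_ne_zero hne
    rw [h, hσ1, Set.indicator_of_mem hmem]
    have h1 : ‖s ω - (f : Ω →ₘ[μ] 𝕜) ω‖ < r := not_le.1 hmem.2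
    have h2 := norm_sub_norm_le ((f : Ω →ₘ[μ] 𝕜) ω) (s ω)
    rw [norm_sub_rev] at h2
    have h3 : r ≤ η := min_le_left _ _
    linarith
  · have h1 : ‖φ - ρ.restrict E hE f‖ ≤
        ‖(r : 𝕜) • (ρ.one : ρ.space 𝕜)‖ + ‖ρ.restrict B hBm f‖ := by
      refine ρ.norm_le_add_of_ae ?_
      rw [Submodule.coe_sub]
      filter_upwards [AEEqFun.coeFn_sub (φ : Ω →ₘ[μ] 𝕜) (ρ.restrict E hE f : Ω →ₘ[μ] 𝕜), hφ,
        ρ.coe_restrict hE f, ρ.coe_restrict hBm f,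
        ρ.norm_smul_one_apply (𝕜 := 𝕜) hr0.le] with ω h1 h2 h3 h4 h5
      rw [h1, Pi.sub_apply, h2, h3, h4, h5, hσ1]
      by_cases hωE : ω ∈ E
      · by_cases hωB : ω ∈ B
        · rw [Set.indicator_of_notMem fun h => h.2 hωB, Set.indicator_of_mem hωE,
            Set.indicator_of_mem hωB, zero_sub, norm_neg]
          linarith
        · rw [Set.indicator_of_mem (Set.mem_sdiff_of_mem hωE hωB), Set.indicator_of_mem hωE,
            Set.indicator_of_notMem hωB, norm_zero, add_zero]
          exact (not_le.1 hωB).le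
      · rw [Set.indicator_of_notMem fun h => hωE h.1, Set.indicator_of_notMem hωE, sub_self,
          norm_zero]
        positivity
    have h2 : ‖(r : 𝕜) • (ρ.one : ρ.space 𝕜)‖ ≤ ε / 2 := by
      rw [ρ.norm_ofReal_smul hr0.le]
      calc r * ‖(ρ.one : ρ.space 𝕜)‖
          ≤ ε / (2 * (‖(ρ.one : ρ.space 𝕜)‖ + 1)) * (‖(ρ.one : ρ.space 𝕜)‖ + 1) := by
            gcongr
            · exact min_le_right _ _
            · linarith
        _ = ε / 2 := by field_simp
    have h3 := hδ B hBm hμB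
    linarith

end SimpleFunctions

/-! ### Disjoint perturbations and part (ii) -/

section Disjointification

/-- Passing to high level sets along a subsequence: the truncation errors are at most `η k`, and
the unions of the later level sets are small with respect to the earlier functions. -/
theorem exists_subsequence_levelSet (htype : HasRademacherType (ρ.space 𝕜) 2)
    (hL2 : (ρ.space 𝕜 : Set (Ω →ₘ[μ] 𝕜)) ⊆ (Lp 𝕜 2 μ : Set (Ω →ₘ[μ] 𝕜)))
    {u : ℕ → ρ.space 𝕜} (hu : Tendsto (fun n => ρ.inclusionL2 hL2 (u n)) atTop (𝓝 0))
    {η : ℕ → ℝ} (hη : ∀ k, 0 < η k) :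
    ∃ k n : ℕ → ℕ, StrictMono k ∧ StrictMono n ∧
      (∀ j, ‖u (n j) - ρ.restrict (levelSet (u (n j) : Ω →ₘ[μ] 𝕜) (k j))
        (measurableSet_levelSet _ _) (u (n j))‖ ≤ η (k j)) ∧
      ∀ j, ‖ρ.restrict (⋃ l, levelSet (u (n (j + 1 + l)) : Ω →ₘ[μ] 𝕜) (k (j + 1 + l)))
        (MeasurableSet.iUnion fun _ => measurableSet_levelSet _ _) (u (n j))‖ ≤ η (k j) := by
  classical
  choose δ hδ0 hδ using fun p : ℕ × ℕ =>
    ρ.exists_forall_measure_le_norm_restrict_le htype (u p.2) (hη p.1)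
  -- The weights sum to less than `1`, so later level sets of measure at most `δ p * w` have a union
  -- of measure at most `δ p`.
  obtain ⟨w, hw0, hw⟩ := ENNReal.exists_pos_sum_of_countable' one_ne_zero ℕ
  -- Pairs of a height and an index are chosen recursively, each related to all earlier pairs.
  obtain ⟨p, hp1, hp2⟩ := exists_seq_of_forall_finset_exists
    (fun p : ℕ × ℕ => ‖u p.2 - ρ.restrict (levelSet (u p.2 : Ω →ₘ[μ] 𝕜) p.1)
        (measurableSet_levelSet _ _) (u p.2)‖ ≤ η p.1)
    (fun p q => p.1 < q.1 ∧ p.2 < q.2 ∧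
      μ (levelSet (u q.2 : Ω →ₘ[μ] 𝕜) q.1) ≤ δ p * w q.1) (by
    intro s _
    set k := s.sup Prod.fst + 1 with hk
    have hk0 : (0 : ℝ) < k := by positivity
    have h1 : ∀ᶠ n in atTop, ∀ p ∈ s, p.2 < n ∧
        μ (levelSet (u n : Ω →ₘ[μ] 𝕜) k) ≤ δ p * w k := by
      rw [eventually_all_finset]
      intro p _
      exact (eventually_gt_atTop p.2).and ((ρ.tendsto_measure_levelSet hL2 hu hk0).eventually_le_const
        (ENNReal.mul_pos (hδ0 p).ne' (hw0 k).ne'))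
    obtain ⟨n, hn1, hn2⟩ :=
      ((ρ.eventually_norm_sub_restrict_levelSet_le htype hL2 hu hk0 (hη k)).and h1).exists
    exact ⟨(k, n), hn1, fun p hp =>
      ⟨Nat.lt_succ_of_le (Finset.le_sup (f := Prod.fst) hp), hn2 p hp⟩⟩)
  have hkm : StrictMono fun j => (p j).1 := fun i j hij => (hp2 i j hij).1
  refine ⟨fun j => (p j).1, fun j => (p j).2, hkm, fun i j hij => (hp2 i j hij).2.1, hp1,
    fun j => hδ (p j) _ _ ?_⟩
  calc μ (⋃ l, levelSet (u (p (j + 1 + l)).2 : Ω →ₘ[μ] 𝕜) (p (j + 1 + l)).1)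
      ≤ ∑' l, μ (levelSet (u (p (j + 1 + l)).2 : Ω →ₘ[μ] 𝕜) (p (j + 1 + l)).1) :=
        measure_iUnion_le _
    _ ≤ ∑' l, δ (p j) * w (p (j + 1 + l)).1 :=
        ENNReal.tsum_le_tsum fun l => (hp2 j (j + 1 + l) (by omega)).2.2
    _ = δ (p j) * ∑' l, w (p (j + 1 + l)).1 := ENNReal.tsum_mul_left
    _ ≤ δ (p j) * ∑' l, w l := by
        refine mul_le_mul_right ?_ _
        exact ENNReal.tsum_comp_le_tsum_of_injective
          (hkm.injective.comp (add_right_injective (j + 1))) w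
    _ ≤ δ (p j) * 1 := by gcongr
    _ = δ (p j) := mul_one _

/-- A function is changed three times: truncated below a high level, cut off the later level sets,
and replaced by a simple function. Bounded coordinate functionals turn summability of these errors
into a congruence. -/
theorem exists_disjointlySupported_congruent
    (hL2 : (ρ.space 𝕜 : Set (Ω →ₘ[μ] 𝕜)) ⊆ (Lp 𝕜 2 μ : Set (Ω →ₘ[μ] 𝕜)))
    (htype : HasRademacherType (ρ.space 𝕜) 2)
    {ψ : ℕ → ρ.space 𝕜} (hsemi : IsSemiNormalized ψ) (hψ : IsBasicSequence 𝕜 ψ)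
    (hinf : (⨅ n, eLpNorm (ψ n : Ω →ₘ[μ] 𝕜) 2 μ) = 0) :
    ∃ (k : ℕ → ℕ) (φ : ℕ → ρ.space 𝕜), StrictMono k ∧
      CongruentSequences 𝕜 (fun j => ψ (k j)) φ ∧
      DisjointlySupported (fun j => (φ j : Ω →ₘ[μ] 𝕜)) ∧
      (∀ j, IsSimple (φ j : Ω →ₘ[μ] 𝕜)) ∧
      EscapesToInfinity (fun j => (φ j : Ω →ₘ[μ] 𝕜)) := by
  obtain ⟨a, b, ha, hab⟩ := hsemi
  obtain ⟨g, M, hg, -, hM⟩ := hψ.exists_bounded_coord ha fun n => (hab n).1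
  have hM0 : 0 ≤ M := (norm_nonneg _).trans (hM 0)
  have hne : ∀ n, ψ n ≠ 0 := fun n => norm_pos_iff.1 (ha.trans_le (hab n).1)
  obtain ⟨σ, hσ, hlim⟩ := ρ.exists_strictMono_tendsto_inclusionL2 hL2 hne hinf
  -- Three errors `η (k j)`, summed geometrically and multiplied by `M`, total at most `M / (M + 1)
  -- < 1`.
  set η : ℕ → ℝ := fun k => 1 / (6 * (M + 1)) * (1 / 2) ^ k with hη
  have hη0 : ∀ k, 0 < η k := fun k => by positivity
  obtain ⟨k, n, hk, hn, htrunc, htail⟩ := ρ.exists_subsequence_levelSet htype hL2 hlim hη0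
  set x : ℕ → ρ.space 𝕜 := fun j => ψ (σ (n j)) with hx
  set E : ℕ → Set Ω := fun j => levelSet (x j : Ω →ₘ[μ] 𝕜) (k j) with hE
  have hEm : ∀ j, MeasurableSet (E j) := fun j => measurableSet_levelSet _ _
  set U : ℕ → Set Ω := fun j => ⋃ l, E (j + 1 + l) with hU
  have hUm : ∀ j, MeasurableSet (U j) := fun j => MeasurableSet.iUnion fun _ => hEm _
  -- With pointwise tolerance `1 / 2`, `|φ j|` stays above `k j - 1 / 2` on its support.
  choose φ hφ1 hφ2 hφ3 hφ4 using fun j => ρ.exists_isSimple_norm_sub_restrict_le htype (x j)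
    ((hEm j).diff (hUm j)) (hη0 (k j)) one_half_pos
  have hdist : ∀ j, ‖φ j - x j‖ ≤ 3 * η (k j) := by
    intro j
    have h1 : ‖ρ.restrict _ ((hEm j).diff (hUm j)) (x j) - ρ.restrict _ (hEm j) (x j)‖ ≤
        ‖ρ.restrict _ (hUm j) (x j)‖ := by
      refine ρ.norm_mono ?_
      rw [Submodule.coe_sub]
      filter_upwards [AEEqFun.coeFn_sub
          (ρ.restrict _ ((hEm j).diff (hUm j)) (x j) : Ω →ₘ[μ] 𝕜)
          (ρ.restrict _ (hEm j) (x j) : Ω →ₘ[μ] 𝕜),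
        ρ.coe_restrict ((hEm j).diff (hUm j)) (x j), ρ.coe_restrict (hEm j) (x j),
        ρ.coe_restrict (hUm j) (x j)] with ω h1 h2 h3 h4
      rw [h1, Pi.sub_apply, h2, h3, h4]
      by_cases hωE : ω ∈ E j
      · by_cases hωU : ω ∈ U j
        · rw [Set.indicator_of_notMem fun h => h.2 hωU, Set.indicator_of_mem hωE,
            Set.indicator_of_mem hωU, zero_sub, norm_neg]
        · rw [Set.indicator_of_mem (Set.mem_sdiff_of_mem hωE hωU), Set.indicator_of_mem hωE,
            sub_self, norm_zero]
          exact norm_nonneg _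
      · rw [Set.indicator_of_notMem fun h => hωE h.1, Set.indicator_of_notMem hωE, sub_self,
          norm_zero]
        exact norm_nonneg _
    have h2 : ‖ρ.restrict _ (hUm j) (x j)‖ ≤ η (k j) := htail j
    have h3 : ‖x j - ρ.restrict _ (hEm j) (x j)‖ ≤ η (k j) := htrunc j
    have h4 := hφ4 j
    have h5 := norm_add₃_le (a := φ j - ρ.restrict _ ((hEm j).diff (hUm j)) (x j))
      (b := ρ.restrict _ ((hEm j).diff (hUm j)) (x j) - ρ.restrict _ (hEm j) (x j))
      (c := ρ.restrict _ (hEm j) (x j) - x j)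
    rw [sub_add_sub_cancel, sub_add_sub_cancel, norm_sub_rev (ρ.restrict _ (hEm j) (x j))] at h5
    linarith
  have hsupp : ∀ i j, i < j →
      ∀ᵐ ω ∂μ, (φ i : Ω →ₘ[μ] 𝕜) ω = 0 ∨ (φ j : Ω →ₘ[μ] 𝕜) ω = 0 := by
    intro i j hij
    filter_upwards [hφ2 i, hφ2 j] with ω h1 h2
    by_contra! hcon
    -- The support of the later function lies in `E j`, which is part of the set `U i` removed from
    -- `E i`.
    refine (h1 hcon.1).2 (Set.mem_iUnion.2 ⟨j - (i + 1), ?_⟩)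
    rw [show i + 1 + (j - (i + 1)) = j by omega]
    exact (h2 hcon.2).1
  refine ⟨fun j => σ (n j), φ, hσ.comp hn, ?_, ?_, hφ1, ?_⟩
  · have hgeom : HasSum (fun j : ℕ => M * (3 * (1 / (6 * (M + 1)))) * (1 / 2 : ℝ) ^ j)
        (M * (3 * (1 / (6 * (M + 1)))) * 2) := hasSum_geometric_two.mul_left _
    refine congruentSequences_of_tsum_lt_one (fun j => g (σ (n j))) (fun i j => ?_)
      (fun j => ?_) hgeom.summable ?_
    · rw [hg]
      exact if_congr (hσ.comp hn).injective.eq_iff rfl rfl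
    · calc ‖g (σ (n j))‖ * ‖φ j - x j‖ ≤ M * (3 * η (k j)) :=
            mul_le_mul (hM _) (hdist j) (norm_nonneg _) hM0
        _ ≤ M * (3 * η j) := by
            simp only [hη]
            gcongr M * (3 * (_ * ?_))
            -- A strictly increasing sequence satisfies `j ≤ k j`.
            exact pow_le_pow_of_le_one (by norm_num) (by norm_num) hk.le_apply
        _ = _ := by simp only [hη]; ring
    · rw [hgeom.tsum_eq]
      have : M * (3 * (1 / (6 * (M + 1)))) * 2 = M / (M + 1) := by field_simp; ring
      rw [this, div_lt_one (by positivity)]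
      linarith
  · intro i j hij
    rcases lt_or_gt_of_ne hij with h | h
    · exact hsupp i j h
    · exact (hsupp j i h).mono fun ω => Or.symm
  · have hbound : ∀ j, ENNReal.ofReal ((k j : ℝ) - 1 / 2) ≤
        essInf (fun ω => ‖(φ j : Ω →ₘ[μ] 𝕜) ω‖ₑ)
          (μ.restrict (Function.support (φ j : Ω →ₘ[μ] 𝕜))) := by
      intro j
      refine le_essInf_of_ae_le _ ?_
      refine (ae_restrict_iff' (φ j : Ω →ₘ[μ] 𝕜).stronglyMeasurable.measurableSet_support).2 ?_
      filter_upwards [hφ2 j, hφ3 j] with ω h1 h2 hω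
      have h3 : (k j : ℝ) < ‖(x j : Ω →ₘ[μ] 𝕜) ω‖ := (h1 hω).1
      rw [← _root_.ofReal_norm]
      refine ENNReal.ofReal_le_ofReal ?_
      have := h2 hω
      linarith
    refine tendsto_nhds_top_mono ?_ (Eventually.of_forall hbound)
    refine ENNReal.tendsto_ofReal_atTop.comp (tendsto_atTop_add_const_right _ _ ?_)
    exact tendsto_natCast_atTop_atTop.comp hk.tendsto_atTop

end Disjointification

end FunctionNorm

theorem mainTheorem1 {Ω : Type*} [MeasurableSpace Ω] (μ : Measure Ω) [IsFiniteMeasure μ]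
    {𝕜 : Type*} [RCLike 𝕜] (ρ : FunctionNorm μ)
    (hL2 : (ρ.space 𝕜 : Set (Ω →ₘ[μ] 𝕜)) ⊆ (Lp 𝕜 2 μ : Set (Ω →ₘ[μ] 𝕜)))
    (htype : HasRademacherType (ρ.space 𝕜) 2)
    (ψ : ℕ → ρ.space 𝕜) (hsemi : IsSemiNormalized ψ)
    (hψ : IsUnconditionalBasicSequence 𝕜 ψ) :
    (0 < (⨅ n, eLpNorm (ψ n : Ω →ₘ[μ] 𝕜) 2 μ) →
      EquivalentSequences 𝕜 ψ (unitVectorL2 𝕜)) ∧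
    ((⨅ n, eLpNorm (ψ n : Ω →ₘ[μ] 𝕜) 2 μ) = 0 →
      ∃ (k : ℕ → ℕ) (φ : ℕ → ρ.space 𝕜), StrictMono k ∧
        CongruentSequences 𝕜 (fun j => ψ (k j)) φ ∧
        DisjointlySupported (fun j => (φ j : Ω →ₘ[μ] 𝕜)) ∧
        (∀ j, IsSimple (φ j : Ω →ₘ[μ] 𝕜)) ∧
        EscapesToInfinity (fun j => (φ j : Ω →ₘ[μ] 𝕜))) := by
  exact ⟨ρ.equivalentSequences_unitVectorL2_of_iInf_pos hL2 htype hsemi hψ,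
    ρ.exists_disjointlySupported_congruent hL2 htype hsemi (hψ 1)⟩
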